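/- **Setting.** Let $\Omega\subset\mathbb R^2$ be open, $T>0$, $\Omega_T=\Omega\times(0,T]$, $d\mu=dx\,dt$, and let $\partial_p\Omega_T=(\partial\Omega\times[0,T])\cup(\Omega\times\{0\})$. A subscript "loc" refers to compact subsets of $\Omega_T$. A field $u\in L^2_{\rm loc}(\Omega_T;\mathbb R^2)$ is a *weak solution of the Euler equations* $\partial_tu+(u\cdot\nabla)u+\nabla p=0$, $\operatorname{div}u=0$ in $\Omega_T$ if for every $\psi\in H^1_0(\Omega)$ and almost every $t\in[0,T]$ one has $\int_\Omega u(x,t)\cdot\nabla\psi(x)\,dx=0$ (whenever this integral exists), and if $$\int_0^T\!\!\int_\Omega u\cdot\partial_t\phi+\sum_{i=1}^2u_i\,(u\cdot\nabla)\phi_i\,dx\,dt=0$$ for every $\phi\in C_c^\infty(\Omega\times(0,T);\mathbb R^2)$ with $\nabla\cdot\phi=0$. Such a $u$ *satisfies the vorticity estimates (VE) with constant $V_o>0$* if its distributional vorticity $\omega=\partial_{x_1}u_2-\partial_{x_2}u_1$ belongs to $L^2_{\rm loc}(\Omega_T)$ and $$\operatorname*{ess\,sup}_{0\le t\le T}\int_\Omega|\omega|^{1+\alpha}\zeta(x,t)\,dx\le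 V_o\int_0^T\!\!\int_\Omega|\omega|^{1+\alpha}\big[|u||\nabla\zeta|+|\partial_t\zeta|\big]\,d\mu$$ for every $\alpha\in[0,1)$ and every non-negative $\zeta\in C^\infty(\Omega_T)$ that vanishes in a neighbourhood of $\partial_p\Omega_T$. For $x_o\in\mathbb R^2$, $t_o\in\mathbb R$, $r>0$ and $s>0$ write $sB=B_{sr}(x_o)$ and $sQ=sB\times(t_o-sr,t_o)$, with $B=1B$. **Statement.** For every $\varepsilon>0$ and $V_o>0$ there is a constant $C=C(\varepsilon,V_o)>0$ with the following property. Let $0<\sigma<1$, let $u$ be a weak solution of the Euler equations in $\Omega_T$ that satisfies (VE) with constant $V_o$, let $\overline{2Q}\subset\Omega_T$, and let $u\in L^{2+\varepsilon}(2Q)$. Put $$\Gamma=2r\Big(\frac1{|2Q|}\int_{2Q}|\omega|^2\,d\mu\Big)^{\frac12}\Big(\frac1{|2Q|}\int_{2Q}\big(|u|^{2+\varepsilon}+1\big)\,d\mu\Big)^{\frac1{2+\varepsilon}}.$$ Then for almost every $(x,t)\in\sigma Q$ the integrals in the following estimates exist and are finite, and: 1. for every $k\in\mathbb R^2$, $$|u(x,t)-k|\le\frac1{2\pi}\int_B\frac{|\omega(y,t)|}{|x-y|}\,dy+\frac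 C{(1-\sigma)^3}\Big[\frac1{|B|}\int_B|u(y,t)-k|\,dy+\Gamma\Big];$$ 2. with $u_{2B}=u_{2B}(t)=\frac1{|2B|}\int_{2B}u(y,t)\,dy$, $$|u(x,t)-u_{2B}|\le\frac1{2\pi}\int_B\frac{|\omega(y,t)|}{|x-y|}\,dy+\frac C{(1-\sigma)^3}\Big[\frac1{|2B|}\int_{2B}|u(y,t)-u_{2B}|\,dy+\Gamma\Big].$$ The constant $C$ does not depend on $t$, $k$, $\sigma$, $r$, $x_o$, $t_o$, $\Omega$, $T$ or $u$. -/

import Mathlib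

open MeasureTheory Set Filter Topology
open scoped ENNReal

namespace EulerLocal

/-- The Euclidean plane. Space-time points are pairs `(x, t) : Plane × ℝ`. -/
abbrev Plane : Type := EuclideanSpace ℝ (Fin 2)

/-- The space-time cylinder `Ω_T = Ω × (0, T]`. -/
def spaceTime (Ω : Set Plane) (T : ℝ) : Set (Plane × ℝ) := Ω ×ˢ Ioc 0 T

/-- The parabolic boundary `(∂Ω × [0, T]) ∪ (Ω × {0})` of `Ω_T`. -/
def parabolicBoundary (Ω : Set Plane) (T : ℝ) : Set (Plane × ℝ) :=
  (frontier Ω ×ˢ Icc 0 T) ∪ (Ω ×ˢ {0})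

/-- The local cylinder `B_r(x₀) × (t₀ - r, t₀)`. -/
def cyl (x₀ : Plane) (t₀ r : ℝ) : Set (Plane × ℝ) :=
  Metric.ball x₀ r ×ˢ Ioo (t₀ - r) t₀

/-- `f ∈ L²_loc(Ω_T)`: square integrable on every compact subset of `Ω × (0, T]`. -/
def MemL2Loc {F : Type*} [NormedAddCommGroup F]
    (Ω : Set Plane) (T : ℝ) (f : Plane × ℝ → F) : Prop :=
  ∀ K : Set (Plane × ℝ), IsCompact K → K ⊆ spaceTime Ω T → MemLp f 2 (volume.restrict K)

/-- The spatial partial derivative `∂_{x_i} f` at the space-time point `z`. -/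
noncomputable def spatialDeriv {F : Type*} [NormedAddCommGroup F] [NormedSpace ℝ F]
    (i : Fin 2) (f : Plane × ℝ → F) (z : Plane × ℝ) : F :=
  fderiv ℝ f z (EuclideanSpace.single i 1, 0)

/-- The time derivative `∂_t f` at the space-time point `z`. -/
noncomputable def timeDeriv {F : Type*} [NormedAddCommGroup F] [NormedSpace ℝ F]
    (f : Plane × ℝ → F) (z : Plane × ℝ) : F :=
  fderiv ℝ f z (0, 1)

/-- `f ∈ C_c^∞(Ω × (0, T))`. -/
def IsTestFunction {F : Type*} [NormedAddCommGroup F] [NormedSpace ℝ F]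
    (Ω : Set Plane) (T : ℝ) (f : Plane × ℝ → F) : Prop :=
  ContDiff ℝ (⊤ : ℕ∞) f ∧ HasCompactSupport f ∧ tsupport f ⊆ Ω ×ˢ Ioo 0 T

/-- `ψ ∈ H_0^1(Ω)` with weak gradient `g`: the pair `(ψ, g)` is the limit in `L²(Ω)` of
pairs `(φ_n, ∇φ_n)` with `φ_n ∈ C_c^∞(Ω)`. -/
def MemH10 (Ω : Set Plane) (ψ : Plane → ℝ) (g : Plane → Plane) : Prop :=
  MemLp ψ 2 (volume.restrict Ω) ∧ MemLp g 2 (volume.restrict Ω) ∧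
  ∃ φ : ℕ → Plane → ℝ,
    (∀ n, ContDiff ℝ (⊤ : ℕ∞) (φ n) ∧ HasCompactSupport (φ n) ∧ tsupport (φ n) ⊆ Ω) ∧
    Tendsto (fun n => eLpNorm (fun x => φ n x - ψ x) 2 (volume.restrict Ω)) atTop (𝓝 0) ∧
    Tendsto (fun n => eLpNorm (fun x => gradient (φ n) x - g x) 2 (volume.restrict Ω))
      atTop (𝓝 0)

/-- Weak solutions in `Ω_T` of `∂_t u + (u·∇)u + ∇p = 0`, `div u = 0`.
As `u` is only locally square integrable, `∫_Ω u(x,t)·∇ψ(x) dx` need not exist for every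
`ψ ∈ H_0^1(Ω)`; it is required to vanish whenever it exists (this includes every
`ψ ∈ C_c^∞(Ω)`, for almost every `t`). -/
structure IsWeakSolution (Ω : Set Plane) (T : ℝ) (u : Plane × ℝ → Plane) : Prop where
  memL2Loc : MemL2Loc Ω T u
  divFree : ∀ (ψ : Plane → ℝ) (g : Plane → Plane), MemH10 Ω ψ g →
    ∀ᵐ t ∂(volume.restrict (Icc 0 T)),
      IntegrableOn (fun x => inner ℝ (u (x, t)) (g x)) Ω →
        ∫ x in Ω, inner ℝ (u (x, t)) (g x) = 0
  momentum : ∀ φ : Plane × ℝ → Plane, IsTestFunction Ω T φ →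
    (∀ z, ∑ i : Fin 2, (spatialDeriv i φ z) i = 0) →
    ∫ z in spaceTime Ω T,
      (inner ℝ (u z) (timeDeriv φ z)
        + ∑ i : Fin 2, u z i * ∑ j : Fin 2, u z j * (spatialDeriv j φ z) i) = 0

/-- `ω = curl u = ∂_{x₁} u₂ - ∂_{x₂} u₁` in the sense of distributions on `Ω × (0, T)`
(coordinates are numbered `0, 1` in the code). -/
def IsVorticity (Ω : Set Plane) (T : ℝ) (u : Plane × ℝ → Plane) (ω : Plane × ℝ → ℝ) : Prop :=
  ∀ φ : Plane × ℝ → ℝ, IsTestFunction Ω T φ →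
    ∫ z in spaceTime Ω T, ω z * φ z =
      - ∫ z in spaceTime Ω T, (u z 1 * spatialDeriv 0 φ z - u z 0 * spatialDeriv 1 φ z)

/-- The vorticity estimates with constant `V₀` for a field `u` with vorticity `ω`.
Both sides of the inequality are integrals of non-negative functions, taken in `[0, ∞]`. -/
structure VorticityEstimates (Ω : Set Plane) (T : ℝ) (u : Plane × ℝ → Plane)
    (ω : Plane × ℝ → ℝ) (V₀ : ℝ) : Prop where
  isVorticity : IsVorticity Ω T u ω
  memL2Loc : MemL2Loc Ω T ω
  estimate : ∀ α : ℝ, 0 ≤ α → α < 1 → ∀ ζ : Plane × ℝ → ℝ,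
    ContDiffOn ℝ (⊤ : ℕ∞) ζ (spaceTime Ω T) → (∀ z ∈ spaceTime Ω T, 0 ≤ ζ z) →
    (∃ U : Set (Plane × ℝ), IsOpen U ∧ parabolicBoundary Ω T ⊆ U ∧
      ∀ z ∈ U ∩ spaceTime Ω T, ζ z = 0) →
    essSup (fun t => ∫⁻ x in Ω, ENNReal.ofReal (|ω (x, t)| ^ (1 + α) * ζ (x, t)))
        (volume.restrict (Icc 0 T))
      ≤ ENNReal.ofReal V₀ * ∫⁻ z in spaceTime Ω T, ENNReal.ofReal
          (|ω z| ^ (1 + α) *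
            (‖u z‖ * ‖gradient (fun x => ζ (x, z.2)) z.1‖ + |timeDeriv ζ z|))

/-- `Γ(2Q) = 2r (⨍_{2Q} |ω|²)^{1/2} (⨍_{2Q} (|u|^{2+ε} + 1))^{1/(2+ε)}` where
`2Q = B_{2r}(x₀) × (t₀ - 2r, t₀)`. -/
noncomputable def Gam (ε : ℝ) (u : Plane × ℝ → Plane) (ω : Plane × ℝ → ℝ)
    (x₀ : Plane) (t₀ r : ℝ) : ℝ :=
  2 * r * (⨍ z in cyl x₀ t₀ (2 * r), |ω z| ^ 2) ^ ((1 : ℝ) / 2) *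
    (⨍ z in cyl x₀ t₀ (2 * r), (‖u z‖ ^ (2 + ε) + 1)) ^ (1 / (2 + ε))

end EulerLocal

/-! The estimate is kinematic: it follows, on almost every time slice, from `div u = 0` and `curl u
= ω` in the sense of distributions. Let `N(z) = z / (2π|z|²)` be the gradient of the fundamental
solution of the Laplacian. Since `div N = δ` and `curl N = 0`, a compactly supported plane field is
recovered from its divergence and curl by convolution with `N` (Biot–Savart). Take a cutoff `ζ` of
`B` with `ζ = 1` on `σB`, and apply this to `ζ(u - k)`. Its curl is `ωζ` plus terms `(u - k)∂ζ`, and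
its divergence consists of such terms only.

As `|N(z)| = 1/(2π|z|)` and `0 ≤ ζ ≤ 1`, the term `ωζ` gives the first integral with the sharp
constant `1/(2π)`. The terms with `∂ζ` live at distance at least `(1-σ)r/3` from `σB`, and `|∂ζ| ≤
M/((1-σ)r)`, so they cost an absolute constant times `(1-σ)⁻²` times the mean of `|u - k|` over `B`.
The quantity `Γ` is non-negative and only enlarges the right side; the constant obtained is
absolute.

As `u` is not smooth, the representation is proved in weak form: the divergence and curl identities
are tested with `ζ · (N_j * η)`, and Fubini moves the kernel from `η` onto the field
(`ae_cutoff_representation`). Pairing the representation with the vector `ζ(u - k)` itself gives the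
bound (`norm_le_of_representation`), hence `exists_interior_estimate`. The identities on slices come
from `ae_divTest` and `ae_curlTest`. One null set serves all `k` because both sides are continuous
in `k`; this permits the choice `k = u_{2B}(t)`, which varies with time. -/

namespace EulerLocal

/-! ### Derivatives in the plane and the size of the Newton kernel. -/

/-- The partial derivative `∂_i f` of a function on the plane. -/
noncomputable def partialDeriv (i : Fin 2) (f : Plane → ℝ) (x : Plane) : ℝ :=
  fderiv ℝ f x (EuclideanSpace.single i 1)

/-- The `j`-th component of `z / (2π |z|²)`, the gradient of the fundamental solution of the
Laplacian in the plane. -/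
noncomputable def newtonKernel (j : Fin 2) (z : Plane) : ℝ :=
  z j / (2 * Real.pi * ‖z‖ ^ 2)

theorem continuous_partialDeriv {f : Plane → ℝ} (hf : ContDiff ℝ 1 f) (i : Fin 2) :
    Continuous (partialDeriv i f) :=
  (hf.continuous_fderiv one_ne_zero).clm_apply continuous_const

theorem partialDeriv_mul {f g : Plane → ℝ} (hf : ContDiff ℝ 1 f) (hg : ContDiff ℝ 1 g)
    (i : Fin 2) (x : Plane) :
    partialDeriv i (fun y => f y * g y) x = f x * partialDeriv i g x + partialDeriv i f x * g x := by
  have hf' : HasFDerivAt f (fderiv ℝ f x) x := ((hf.differentiable one_ne_zero) x).hasFDerivAt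
  have hg' : HasFDerivAt g (fderiv ℝ g x) x := ((hg.differentiable one_ne_zero) x).hasFDerivAt
  have h : HasFDerivAt (fun y => f y * g y) _ x := hf'.mul hg'
  simp only [partialDeriv]
  rw [h.fderiv]
  simp [mul_comm]

theorem fderiv_eq_partialDeriv (f : Plane → ℝ) (x v : Plane) :
    fderiv ℝ f x v = v 0 * partialDeriv 0 f x + v 1 * partialDeriv 1 f x := by
  have hv : v = v 0 • EuclideanSpace.single (0 : Fin 2) (1 : ℝ)
      + v 1 • EuclideanSpace.single (1 : Fin 2) (1 : ℝ) := by
    ext i; fin_cases i <;> simp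
  conv_lhs => rw [hv]
  simp [partialDeriv]

theorem abs_newtonKernel_le (j : Fin 2) (z : Plane) :
    |newtonKernel j z| ≤ 1 / (2 * Real.pi) * ‖z‖⁻¹ := by
  rcases eq_or_ne z 0 with rfl | hz
  · simp [newtonKernel]
  have hz' : 0 < ‖z‖ := norm_pos_iff.mpr hz
  have h1 : |z j| ≤ ‖z‖ := PiLp.norm_apply_le z j
  have hpi := Real.pi_pos
  rw [newtonKernel, abs_div, abs_of_pos (by positivity : 0 < 2 * Real.pi * ‖z‖ ^ 2)]
  rw [div_le_iff₀ (by positivity)]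
  calc |z j| ≤ ‖z‖ := h1
    _ = _ := by field_simp

/-- In polar coordinates the Jacobian `s` cancels `s⁻¹`, which leaves the constant 1 on `(0, R]`. -/
theorem locallyIntegrable_norm_inv : LocallyIntegrable (fun z : Plane => ‖z‖⁻¹) := by
  rw [locallyIntegrable_iff]
  intro K hK
  obtain ⟨R, hR⟩ := hK.isBounded.subset_closedBall (0 : Plane)
  have h : Integrable (fun z : Plane => (Iic R).indicator (fun s : ℝ => s⁻¹) ‖z‖) := by
    rw [integrable_fun_norm_addHaar]
    have h1 : IntegrableOn (fun _ : ℝ => (1 : ℝ)) (Ioc 0 R) := by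
      simp [integrableOn_const_iff]
    refine (IntegrableOn.of_forall_sdiff_eq_zero (s := Ioc 0 R)
      (f := fun y : ℝ => y ^ (Module.finrank ℝ Plane - 1) • (Iic R).indicator (fun s : ℝ => s⁻¹) y)
      (h1.congr_fun ?_ measurableSet_Ioc) measurableSet_Ioi ?_)
    · intro y hy
      have : y ≠ 0 := hy.1.ne'
      simp [hy.2, this]
    · intro y hy
      have : ¬ y ≤ R := fun h => hy.2 ⟨hy.1, h⟩
      simp [this]
  refine (h.integrableOn (s := Metric.closedBall 0 R)).congr_fun ?_
    Metric.isClosed_closedBall.measurableSet |>.mono_set hR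
  intro z hz
  have : ‖z‖ ≤ R := by simpa using hz
  simp [this]

theorem measurable_newtonKernel (j : Fin 2) : Measurable (newtonKernel j) := by
  unfold newtonKernel
  fun_prop

theorem locallyIntegrable_newtonKernel (j : Fin 2) : LocallyIntegrable (newtonKernel j) := by
  refine (locallyIntegrable_norm_inv.smul (1 / (2 * Real.pi))).mono
    (measurable_newtonKernel j).aestronglyMeasurable (Eventually.of_forall fun z => ?_)
  have hpi := Real.pi_pos
  refine (abs_newtonKernel_le j z).trans (le_of_eq ?_)
  simp [abs_of_pos hpi]

/-! ### Polar coordinates: the Newton kernel has divergence `δ` and curl zero. -/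

/-- The point of the plane with polar coordinates `(s, θ)`. -/
noncomputable def polarPoint (s θ : ℝ) : Plane := !₂[s * Real.cos θ, s * Real.sin θ]

theorem norm_polarPoint (s θ : ℝ) : ‖polarPoint s θ‖ = |s| := by
  rw [EuclideanSpace.norm_eq, ← Real.sqrt_sq_eq_abs]
  congr 1
  simp only [polarPoint, Fin.sum_univ_two, Real.norm_eq_abs, sq_abs]
  simp
  nlinarith [Real.sin_sq_add_cos_sq θ]

theorem integral_plane_eq_polar (G : Plane → ℝ) :
    ∫ z, G z = ∫ p in Ioi (0 : ℝ) ×ˢ Ioo (-Real.pi) Real.pi, p.1 * G (polarPoint p.1 p.2) := by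
  have e1 := (EuclideanSpace.volume_preserving_symm_measurableEquiv_toLp (Fin 2)).symm
  have e2 := (volume_preserving_finTwoArrow ℝ).symm
  have h1 := e1.integral_comp' (g := G)
  have h2 := e2.integral_comp' (g := fun v => G ((MeasurableEquiv.toLp 2 (Fin 2 → ℝ)).symm.symm v))
  rw [← h1, ← h2, ← integral_comp_polarCoord_symm]
  rfl

theorem continuous_polarPoint : Continuous fun p : ℝ × ℝ => polarPoint p.1 p.2 := by
  unfold polarPoint
  refine (PiLp.continuous_toLp 2 _).comp (continuous_pi fun i => ?_)
  fin_cases i <;> simp <;> fun_prop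

theorem hasDerivAt_polarPoint_radial (s θ : ℝ) :
    HasDerivAt (fun s => polarPoint s θ) (polarPoint 1 θ) s := by
  have h : (fun s => polarPoint s θ) = fun s => s • polarPoint 1 θ := by
    ext s i; fin_cases i <;> simp [polarPoint]
  rw [h]
  simpa using (hasDerivAt_id s).smul_const (polarPoint 1 θ)

theorem hasDerivAt_polarPoint_angular (s θ : ℝ) :
    HasDerivAt (fun θ => polarPoint s θ) !₂[-(s * Real.sin θ), s * Real.cos θ] θ := by
  have h : (fun θ => polarPoint s θ) = fun θ =>
      (s * Real.cos θ) • EuclideanSpace.single (0 : Fin 2) (1 : ℝ)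
        + (s * Real.sin θ) • EuclideanSpace.single (1 : Fin 2) (1 : ℝ) := by
    ext θ i; fin_cases i <;> simp [polarPoint]
  rw [h]
  refine ((((Real.hasDerivAt_cos θ).const_mul s).smul_const _).add
    (((Real.hasDerivAt_sin θ).const_mul s).smul_const _)).congr_deriv ?_
  ext i; fin_cases i <;> simp

theorem integrableOn_polar {f : ℝ × ℝ → ℝ} (hf : Continuous f) {R : ℝ}
    (hR : ∀ p : ℝ × ℝ, R < p.1 → f p = 0) :
    IntegrableOn f (Ioi (0 : ℝ) ×ˢ Ioo (-Real.pi) Real.pi) := by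
  refine IntegrableOn.of_forall_sdiff_eq_zero
    (hf.continuousOn.integrableOn_compact (isCompact_Icc.prod isCompact_Icc) :
      IntegrableOn f (Icc 0 R ×ˢ Icc (-Real.pi) Real.pi)) (measurableSet_Ioi.prod measurableSet_Ioo) ?_
  rintro ⟨s, θ⟩ ⟨⟨hs, hθ⟩, h⟩
  refine hR _ ?_
  by_contra hc
  exact h ⟨⟨le_of_lt hs, not_lt.mp hc⟩, hθ.1.le, hθ.2.le⟩

theorem polar_support {h : Plane → ℝ} (hc : HasCompactSupport h) :
    ∃ R : ℝ, 0 < R ∧ (∀ s θ : ℝ, R < s → h (polarPoint s θ) = 0) ∧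
      ∀ s θ : ℝ, ∀ i, R < s → partialDeriv i h (polarPoint s θ) = 0 := by
  obtain ⟨R, hR⟩ := hc.isCompact.isBounded.subset_closedBall (0 : Plane)
  have key : ∀ s θ : ℝ, max R 1 < s → polarPoint s θ ∉ tsupport h := by
    intro s θ hs hmem
    have h1 := hR hmem
    rw [mem_closedBall_zero_iff, norm_polarPoint] at h1
    exact absurd ((le_abs_self s).trans h1) (not_le.mpr ((le_max_left _ _).trans_lt hs))
  refine ⟨max R 1, by positivity, fun s θ hs => image_eq_zero_of_notMem_tsupport (key s θ hs),
    fun s θ i hs => ?_⟩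
  have := notMem_subset (tsupport_fderiv_subset ℝ (f := h)) (key s θ hs)
  simp [partialDeriv, image_eq_zero_of_notMem_tsupport this]

/-- This is `div N = δ`. In polar coordinates the Jacobian cancels the singularity and the integrand
becomes `∂_s h / (2π)`. Each ray contributes `-h(0)/(2π)`, and the angles have total length `2π`. -/
theorem integral_newtonKernel_partialDeriv {h : Plane → ℝ} (hh : ContDiff ℝ 1 h)
    (hc : HasCompactSupport h) :
    ∫ z, (newtonKernel 0 z * partialDeriv 0 h z + newtonKernel 1 z * partialDeriv 1 h z)
      = - h 0 := by
  obtain ⟨R, hR0, hR, hR'⟩ := polar_support hc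
  have hpi := Real.pi_pos
  set H : ℝ × ℝ → ℝ := fun p => Real.cos p.2 * partialDeriv 0 h (polarPoint p.1 p.2)
    + Real.sin p.2 * partialDeriv 1 h (polarPoint p.1 p.2) with hH
  have hHc : Continuous H := by
    have h0 := (continuous_partialDeriv hh 0).comp continuous_polarPoint
    have h1 := (continuous_partialDeriv hh 1).comp continuous_polarPoint
    simp only [Function.comp_def] at h0 h1
    fun_prop
  have hHR : ∀ p : ℝ × ℝ, R < p.1 → H p = 0 := by
    intro p hp
    simp [H, hR' p.1 p.2 _ hp]
  have hint := integrableOn_polar hHc hHR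
  have hder : ∀ θ s : ℝ, HasDerivAt (fun s => h (polarPoint s θ)) (H (s, θ)) s := by
    intro θ s
    have h1 := ((hh.differentiable one_ne_zero) (polarPoint s θ)).hasFDerivAt.comp_hasDerivAt s
      (hasDerivAt_polarPoint_radial s θ)
    rw [fderiv_eq_partialDeriv] at h1
    refine h1.congr_deriv ?_
    simp [polarPoint, H]
  have hrad : ∀ θ : ℝ, ∫ s in Ioi (0 : ℝ), H (s, θ) = - h 0 := by
    intro θ
    have hz : polarPoint 0 θ = 0 := by
      ext i; fin_cases i <;> simp [polarPoint]
    rw [integral_Ioi_of_hasDerivAt_of_tendsto (m := 0)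
      (hder θ 0).continuousAt.continuousWithinAt (fun s _ => hder θ s)]
    · simp [hz]
    · refine IntegrableOn.of_forall_sdiff_eq_zero (s := Icc 0 R)
        ((hHc.comp (by fun_prop : Continuous fun s : ℝ => (s, θ))).continuousOn.integrableOn_compact
          isCompact_Icc) measurableSet_Ioi ?_
      intro s hs
      exact hHR (s, θ) (not_le.mp fun hle => hs.2 ⟨le_of_lt hs.1, hle⟩)
    · refine tendsto_const_nhds.congr' ?_
      filter_upwards [eventually_gt_atTop R] with s hs
      exact (hR s θ hs).symm
  rw [integral_plane_eq_polar]
  have hcongr : ∀ p ∈ Ioi (0 : ℝ) ×ˢ Ioo (-Real.pi) Real.pi,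
      p.1 * (newtonKernel 0 (polarPoint p.1 p.2) * partialDeriv 0 h (polarPoint p.1 p.2)
        + newtonKernel 1 (polarPoint p.1 p.2) * partialDeriv 1 h (polarPoint p.1 p.2))
      = 1 / (2 * Real.pi) * H p := by
    rintro ⟨s, θ⟩ ⟨hs, -⟩
    have hs : s ≠ 0 := ne_of_gt hs
    simp only [newtonKernel, norm_polarPoint, sq_abs, H]
    simp only [polarPoint, PiLp.toLp_apply, Matrix.cons_val_zero, Matrix.cons_val_one]
    field_simp
  rw [setIntegral_congr_fun (measurableSet_Ioi.prod measurableSet_Ioo) hcongr,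
    integral_const_mul, Measure.volume_eq_prod, ← Measure.prod_restrict, integral_prod_symm]
  · simp only [hrad, integral_const, measureReal_restrict_apply_univ, Real.volume_real_Ioo]
    rw [max_eq_left (by linarith), smul_eq_mul]
    field_simp
    ring
  · rw [Measure.prod_restrict]
    exact hint

/-- This is `curl N = 0`. Up to a constant the integrand, Jacobian included, is the angular
derivative of `h` divided by `s`, whose integral over each circle vanishes by periodicity. -/
theorem integral_newtonKernel_partialDeriv_perp {h : Plane → ℝ} (hh : ContDiff ℝ 1 h)
    (hc : HasCompactSupport h) :
    ∫ z, (newtonKernel 1 z * partialDeriv 0 h z - newtonKernel 0 z * partialDeriv 1 h z) = 0 := by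
  obtain ⟨R, hR0, hR, hR'⟩ := polar_support hc
  have hpi := Real.pi_pos
  set H : ℝ × ℝ → ℝ := fun p => - Real.sin p.2 * partialDeriv 0 h (polarPoint p.1 p.2)
    + Real.cos p.2 * partialDeriv 1 h (polarPoint p.1 p.2) with hH
  have hHc : Continuous H := by
    have h0 := (continuous_partialDeriv hh 0).comp continuous_polarPoint
    have h1 := (continuous_partialDeriv hh 1).comp continuous_polarPoint
    simp only [Function.comp_def] at h0 h1
    fun_prop
  have hHR : ∀ p : ℝ × ℝ, R < p.1 → H p = 0 := by
    intro p hp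
    simp [H, hR' p.1 p.2 _ hp]
  have hint := integrableOn_polar hHc hHR
  have hder : ∀ s θ : ℝ, HasDerivAt (fun θ => h (polarPoint s θ)) (s * H (s, θ)) θ := by
    intro s θ
    have h1 := ((hh.differentiable one_ne_zero) (polarPoint s θ)).hasFDerivAt.comp_hasDerivAt θ
      (hasDerivAt_polarPoint_angular s θ)
    rw [fderiv_eq_partialDeriv] at h1
    refine h1.congr_deriv ?_
    simp [H]
    ring
  have hang : ∀ s ∈ Ioi (0 : ℝ), ∫ θ in Ioo (-Real.pi) Real.pi, H (s, θ) = 0 := by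
    intro s hs
    have hs : s ≠ 0 := ne_of_gt hs
    have hcont : Continuous fun θ => s * H (s, θ) := by fun_prop
    have h1 := intervalIntegral.integral_eq_sub_of_hasDerivAt (a := -Real.pi) (b := Real.pi)
      (fun θ _ => hder s θ) (hcont.intervalIntegrable _ _)
    rw [intervalIntegral.integral_of_le (by linarith), integral_Ioc_eq_integral_Ioo,
      integral_const_mul] at h1
    have h2 : polarPoint s Real.pi = polarPoint s (-Real.pi) := by simp [polarPoint]
    rw [h2, sub_self] at h1
    exact (mul_eq_zero.mp h1).resolve_left hs
  rw [integral_plane_eq_polar]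
  have hcongr : ∀ p ∈ Ioi (0 : ℝ) ×ˢ Ioo (-Real.pi) Real.pi,
      p.1 * (newtonKernel 1 (polarPoint p.1 p.2) * partialDeriv 0 h (polarPoint p.1 p.2)
        - newtonKernel 0 (polarPoint p.1 p.2) * partialDeriv 1 h (polarPoint p.1 p.2))
      = - (1 / (2 * Real.pi)) * H p := by
    rintro ⟨s, θ⟩ ⟨hs, -⟩
    have hs : s ≠ 0 := ne_of_gt hs
    simp only [newtonKernel, norm_polarPoint, sq_abs, H]
    simp only [polarPoint, PiLp.toLp_apply, Matrix.cons_val_zero, Matrix.cons_val_one]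
    field_simp
    ring
  rw [setIntegral_congr_fun (measurableSet_Ioi.prod measurableSet_Ioo) hcongr,
    integral_const_mul, Measure.volume_eq_prod, setIntegral_prod _ hint,
    setIntegral_congr_fun measurableSet_Ioi hang]
  simp

/-! ### Newton potentials of test functions. -/

/-- The convolution of the `j`-th component of the Newton kernel with `η`. -/
noncomputable def newtonPotential (j : Fin 2) (η : Plane → ℝ) : Plane → ℝ :=
  convolution (newtonKernel j) η (ContinuousLinearMap.mul ℝ ℝ) volume

theorem newtonPotential_apply (j : Fin 2) (η : Plane → ℝ) (y : Plane) :
    newtonPotential j η y = ∫ x, newtonKernel j (y - x) * η x := by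
  rw [newtonPotential, convolution_eq_swap]
  rfl

theorem contDiff_newtonPotential (j : Fin 2) {η : Plane → ℝ} (hη : ContDiff ℝ (⊤ : ℕ∞) η)
    (hc : HasCompactSupport η) : ContDiff ℝ (⊤ : ℕ∞) (newtonPotential j η) :=
  hc.contDiff_convolution_right _ (locallyIntegrable_newtonKernel j) hη

theorem hasCompactSupport_partialDeriv {f : Plane → ℝ} (hc : HasCompactSupport f) (i : Fin 2) :
    HasCompactSupport (partialDeriv i f) :=
  hc.fderiv_apply ℝ _

theorem integrable_newtonKernel_mul (j : Fin 2) {g : Plane → ℝ} (hg : Continuous g)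
    (hc : HasCompactSupport g) : Integrable fun z => newtonKernel j z * g z := by
  simpa [mul_comm] using
    (locallyIntegrable_newtonKernel j).integrable_smul_right_of_hasCompactSupport hg hc

/-- The derivative falls on `η`; the sign is the chain rule for `z ↦ η (y - z)`. In this form the
two kernel identities apply with `h = η (y - ·)`, for which `h 0 = η y`. -/
theorem partialDeriv_newtonPotential (i j : Fin 2) {η : Plane → ℝ} (hη : ContDiff ℝ 1 η)
    (hc : HasCompactSupport η) (y : Plane) :
    partialDeriv i (newtonPotential j η) y
      = - ∫ z, newtonKernel j z * partialDeriv i (fun w => η (y - w)) z := by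
  have h1 := hc.hasFDerivAt_convolution_right (μ := volume) (ContinuousLinearMap.mul ℝ ℝ)
    (locallyIntegrable_newtonKernel j) hη y
  have hex : ConvolutionExistsAt (newtonKernel j) (fderiv ℝ η) y
      (ContinuousLinearMap.precompR Plane (ContinuousLinearMap.mul ℝ ℝ)) volume :=
    (hc.fderiv ℝ).convolutionExists_right _ (locallyIntegrable_newtonKernel j)
      (hη.continuous_fderiv one_ne_zero) y
  rw [partialDeriv, newtonPotential, h1.fderiv, convolution,
    ContinuousLinearMap.integral_apply hex, ← integral_neg]
  refine integral_congr_ae (Eventually.of_forall fun z => ?_)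
  have h2 : HasFDerivAt (fun w => η (y - w)) _ z :=
    ((hη.differentiable one_ne_zero) (y - z)).hasFDerivAt.comp z
      ((hasFDerivAt_const y z).sub (hasFDerivAt_id z))
  simp only [partialDeriv, h2.fderiv]
  simp

theorem contDiff_comp_sub_left {η : Plane → ℝ} {n : WithTop ℕ∞} (hη : ContDiff ℝ n η) (y : Plane) :
    ContDiff ℝ n (fun w => η (y - w)) :=
  hη.comp (contDiff_const.sub contDiff_id)

theorem hasCompactSupport_comp_sub_left {η : Plane → ℝ} (hc : HasCompactSupport η) (y : Plane) :
    HasCompactSupport (fun w => η (y - w)) :=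
  hc.comp_homeomorph (Homeomorph.subLeft y)

theorem partialDeriv_newtonPotential_add {η : Plane → ℝ} (hη : ContDiff ℝ 1 η)
    (hc : HasCompactSupport η) (y : Plane) :
    partialDeriv 0 (newtonPotential 0 η) y + partialDeriv 1 (newtonPotential 1 η) y = η y := by
  have h1 := contDiff_comp_sub_left hη y
  have h2 := hasCompactSupport_comp_sub_left hc y
  have h := integral_newtonKernel_partialDeriv h1 h2
  rw [integral_add (integrable_newtonKernel_mul 0 (continuous_partialDeriv h1 0)
      (hasCompactSupport_partialDeriv h2 0)) (integrable_newtonKernel_mul 1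
      (continuous_partialDeriv h1 1) (hasCompactSupport_partialDeriv h2 1)), sub_zero] at h
  rw [partialDeriv_newtonPotential 0 0 hη hc, partialDeriv_newtonPotential 1 1 hη hc]
  linarith

theorem partialDeriv_newtonPotential_comm {η : Plane → ℝ} (hη : ContDiff ℝ 1 η)
    (hc : HasCompactSupport η) (y : Plane) :
    partialDeriv 0 (newtonPotential 1 η) y = partialDeriv 1 (newtonPotential 0 η) y := by
  have h1 := contDiff_comp_sub_left hη y
  have h2 := hasCompactSupport_comp_sub_left hc y
  have h := integral_newtonKernel_partialDeriv_perp h1 h2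
  rw [integral_sub (integrable_newtonKernel_mul 1 (continuous_partialDeriv h1 0)
      (hasCompactSupport_partialDeriv h2 0)) (integrable_newtonKernel_mul 0
      (continuous_partialDeriv h1 1) (hasCompactSupport_partialDeriv h2 1))] at h
  rw [partialDeriv_newtonPotential 0 1 hη hc, partialDeriv_newtonPotential 1 0 hη hc]
  linarith

/-! ### Fubini for the singular kernel. -/

/-- By translation invariance the inner integral of `|g (p a - x)|` does not depend on `a`, so the
double integral is the product of two `L¹` norms. -/
theorem integrable_prod_mul_comp_sub {α : Type*} [MeasurableSpace α] {m : Measure α} {f : α → ℝ} (hf : Integrable f m) {p : α → Plane}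
    (hp : Measurable p) {g : Plane → ℝ} (hg : Integrable g) (hgm : Measurable g) :
    Integrable (fun q : α × Plane => f q.1 * g (p q.1 - q.2)) (m.prod volume) := by
  have hm : AEStronglyMeasurable (fun q : α × Plane => f q.1 * g (p q.1 - q.2))
      (m.prod volume) :=
    hf.1.comp_fst.mul (hgm.comp ((hp.comp measurable_fst).sub measurable_snd)).aestronglyMeasurable
  rw [integrable_prod_iff hm]
  refine ⟨Eventually.of_forall fun a => (hg.comp_sub_left (p a)).const_mul (f a), ?_⟩
  have h : ∀ a, ∫ x, ‖f a * g (p a - x)‖ = ‖f a‖ * ∫ x, ‖g x‖ := by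
    intro a
    simp only [norm_mul]
    rw [integral_const_mul, integral_sub_left_eq_self (fun x => ‖g x‖) volume (p a)]
  simp only [h]
  exact hf.norm.mul_const _

/-- Two points of the ball differ by at most `2r`, so a locally integrable kernel may be cut off
outside `closedBall 0 (2 * r)`, which makes it integrable. -/
theorem integrable_prod_mul_kernel {α : Type*} [MeasurableSpace α] {m : Measure α} {f : α → ℝ} (hf : Integrable f m) {p : α → Plane}
    (hp : Measurable p) {x₀ : Plane} {r : ℝ} (hpr : ∀ᵐ a ∂m, p a ∈ Metric.ball x₀ r)
    {k : Plane → ℝ} (hk : LocallyIntegrable k) (hkm : Measurable k) :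
    Integrable (fun q : α × Plane => f q.1 * k (p q.1 - q.2))
      (m.prod (volume.restrict (Metric.ball x₀ r))) := by
  have hk' : Integrable ((Metric.closedBall 0 (2 * r)).indicator k) :=
    (integrable_indicator_iff Metric.isClosed_closedBall.measurableSet).mpr
      (hk.integrableOn_isCompact (isCompact_closedBall _ _))
  have h := integrable_prod_mul_comp_sub hf hp hk'
    (hkm.indicator Metric.isClosed_closedBall.measurableSet)
  have h2 : Integrable (fun q : α × Plane =>
      f q.1 * (Metric.closedBall 0 (2 * r)).indicator k (p q.1 - q.2))
      (m.prod (volume.restrict (Metric.ball x₀ r))) :=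
    h.mono_measure (Measure.prod_mono le_rfl Measure.restrict_le_self)
  refine h2.congr ?_
  have h3 : ∀ᵐ q ∂(m.prod (volume.restrict (Metric.ball x₀ r))), p q.1 ∈ Metric.ball x₀ r :=
    Measure.quasiMeasurePreserving_fst.ae hpr
  have h4 : ∀ᵐ q ∂(m.prod (volume.restrict (Metric.ball x₀ r))), q.2 ∈ Metric.ball x₀ r :=
    Measure.quasiMeasurePreserving_snd.ae (ae_restrict_mem Metric.isOpen_ball.measurableSet)
  filter_upwards [h3, h4] with q h3 h4
  rw [indicator_of_mem]
  rw [mem_closedBall_zero_iff, ← dist_eq_norm]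
  rw [Metric.mem_ball] at h3 h4
  have := dist_triangle_right (p q.1) q.2 x₀
  linarith

/-- Fubini moves the convolution from `η` onto `f`, so that `η` remains as a bare test function. -/
theorem setIntegral_mul_newtonPotential {x₀ : Plane} {r : ℝ} {f : Plane → ℝ}
    (hf : IntegrableOn f (Metric.ball x₀ r)) (j : Fin 2) {η : Plane → ℝ} (hη : Continuous η)
    (hc : HasCompactSupport η) (hs : tsupport η ⊆ Metric.ball x₀ r) :
    ∫ y in Metric.ball x₀ r, f y * newtonPotential j η y
      = ∫ x in Metric.ball x₀ r, η x * ∫ y in Metric.ball x₀ r, newtonKernel j (y - x) * f y := by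
  have h1 := integrable_prod_mul_kernel hf measurable_id
    (ae_restrict_mem Metric.isOpen_ball.measurableSet) (locallyIntegrable_newtonKernel j)
    (measurable_newtonKernel j)
  obtain ⟨C, hC⟩ := hη.bounded_above_of_compact_support hc
  have h2 : Integrable (Function.uncurry fun y x => f y * newtonKernel j (y - x) * η x)
      ((volume.restrict (Metric.ball x₀ r)).prod (volume.restrict (Metric.ball x₀ r))) :=
    h1.mul_bdd (hη.comp continuous_snd).aestronglyMeasurable
      (Eventually.of_forall fun q => hC q.2)
  have h3 : ∀ y, f y * newtonPotential j η y
      = ∫ x in Metric.ball x₀ r, f y * newtonKernel j (y - x) * η x := by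
    intro y
    rw [newtonPotential_apply, ← integral_const_mul,
      setIntegral_eq_integral_of_forall_compl_eq_zero]
    · exact integral_congr_ae (Eventually.of_forall fun x => (mul_assoc _ _ _).symm)
    · intro x hx
      rw [image_eq_zero_of_notMem_tsupport fun h => hx (hs h), mul_zero]
  simp only [h3]
  rw [integral_integral_swap h2]
  refine integral_congr_ae (Eventually.of_forall fun x => ?_)
  simp only
  rw [← integral_const_mul]
  exact integral_congr_ae (Eventually.of_forall fun y => by ring)

/-- Swaps the two space variables at a common time. It turns integrability with `f` at the
evaluation point into integrability with `f` under the kernel integral. -/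
theorem measurePreserving_exchange (μ : Measure Plane) (ν : Measure ℝ) [SFinite μ] [SFinite ν] :
    MeasurePreserving (fun q : (Plane × ℝ) × Plane => ((q.2, q.1.2), q.1.1))
      ((μ.prod ν).prod μ) ((μ.prod ν).prod μ) := by
  have h1 : MeasurePreserving Prod.swap ((μ.prod ν).prod μ) (μ.prod (μ.prod ν)) :=
    Measure.measurePreserving_swap
  have h2 : MeasurePreserving (Prod.map id Prod.swap) (μ.prod (μ.prod ν)) (μ.prod (ν.prod μ)) :=
    (MeasurePreserving.id μ).prod Measure.measurePreserving_swap
  have h3 := (measurePreserving_prodAssoc μ ν μ).symm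
  exact h3.comp (h2.comp h1)

theorem integrable_exchange_kernel {x₀ : Plane} {r : ℝ} {ν : Measure ℝ} [SFinite ν]
    {f : Plane × ℝ → ℝ} (hf : Integrable f ((volume.restrict (Metric.ball x₀ r)).prod ν))
    {k : Plane → ℝ} (hk : LocallyIntegrable k) (hkm : Measurable k) :
    Integrable (fun q : (Plane × ℝ) × Plane => k (q.2 - q.1.1) * f (q.2, q.1.2))
      (((volume.restrict (Metric.ball x₀ r)).prod ν).prod (volume.restrict (Metric.ball x₀ r))) := by
  have h := integrable_prod_mul_kernel hf measurable_fst
    (Measure.quasiMeasurePreserving_fst.ae (ae_restrict_mem Metric.isOpen_ball.measurableSet)) hk hkm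
  have h2 := (measurePreserving_exchange (volume.restrict (Metric.ball x₀ r)) ν).integrable_comp_of_integrable h
  simpa [Function.comp_def, mul_comm] using h2

/-! ### Vanishing of space-time functions tested slice by slice. -/

theorem ae_eq_zero_of_setIntegral_rectangle_eq_zero {α β : Type*} [MeasurableSpace α]
    [MeasurableSpace β] {μ : Measure α} {ν : Measure β} [SFinite μ] [SFinite ν] {F : α × β → ℝ}
    (hF : Integrable F (μ.prod ν))
    (h : ∀ S A, MeasurableSet S → MeasurableSet A → ∫ z in S ×ˢ A, F z ∂(μ.prod ν) = 0) :
    F =ᵐ[μ.prod ν] 0 := by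
  refine hF.ae_eq_zero_of_forall_setIntegral_eq_zero fun s hs hfin => ?_
  -- The π-λ induction runs over all measurable sets: finite measure is not stable under
  -- complements.
  clear hfin
  have huniv : ∫ z, F z ∂(μ.prod ν) = 0 := by
    simpa using h univ univ MeasurableSet.univ MeasurableSet.univ
  induction s, hs using MeasurableSpace.induction_on_inter generateFrom_prod.symm isPiSystem_prod with
  | empty => simp
  | basic t ht =>
    obtain ⟨S, hS, A, hA, rfl⟩ := ht
    exact h S A hS hA
  | compl t ht ih =>
    have := integral_add_compl ht hF
    linarith
  | iUnion t hd ht ih =>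
    rw [integral_iUnion ht hd hF.integrableOn]
    simp [ih]

/-- The exceptional null set of times depends on `η`, so slices cannot be treated one at a time.
Integrating first over a time set `A` gives a function of `x` that is orthogonal to every `η` and
hence vanishes a.e.; varying `A` then covers all rectangles. -/
theorem ae_eq_zero_of_forall_test {x₀ : Plane} {r : ℝ} {ν : Measure ℝ} [SFinite ν]
    {F : Plane × ℝ → ℝ} (hF : Integrable F ((volume.restrict (Metric.ball x₀ r)).prod ν))
    (h : ∀ η : Plane → ℝ, ContDiff ℝ (⊤ : ℕ∞) η → HasCompactSupport η →
      tsupport η ⊆ Metric.ball x₀ r →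
      ∀ᵐ t ∂ν, ∫ x in Metric.ball x₀ r, η x * F (x, t) = 0) :
    F =ᵐ[(volume.restrict (Metric.ball x₀ r)).prod ν] 0 := by
  set μ := volume.restrict (Metric.ball x₀ r) with hμ
  refine ae_eq_zero_of_setIntegral_rectangle_eq_zero hF fun S A hS hA => ?_
  rw [setIntegral_prod _ hF.integrableOn]
  have hFA : Integrable F (μ.prod (ν.restrict A)) :=
    hF.mono_measure (Measure.prod_mono le_rfl Measure.restrict_le_self)
  have hint : Integrable (fun x => ∫ t in A, F (x, t) ∂ν) μ := hFA.integral_prod_left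
  have hz : ∀ᵐ x, x ∈ Metric.ball x₀ r → ∫ t in A, F (x, t) ∂ν = 0 := by
    refine Metric.isOpen_ball.ae_eq_zero_of_integral_contDiff_smul_eq_zero
      (IntegrableOn.locallyIntegrableOn hint) fun η hη hc hs => ?_
    have h1 : ∫ x, η x • ∫ t in A, F (x, t) ∂ν
        = ∫ x, (∫ t in A, η x * F (x, t) ∂ν) ∂μ := by
      rw [hμ, setIntegral_eq_integral_of_forall_compl_eq_zero]
      · simp only [integral_const_mul, smul_eq_mul]
      · intro x hx
        simp [image_eq_zero_of_notMem_tsupport fun h => hx (hs h)]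
    obtain ⟨C, hC⟩ := hη.continuous.bounded_above_of_compact_support hc
    have h2 : Integrable (Function.uncurry fun x t => η x * F (x, t)) (μ.prod (ν.restrict A)) :=
      hFA.bdd_mul (hη.continuous.comp continuous_fst).aestronglyMeasurable
        (Eventually.of_forall fun q => hC q.1)
    rw [h1, integral_integral_swap h2]
    refine integral_eq_zero_of_ae ?_
    exact ae_restrict_of_ae (h η hη hc hs)
  refine integral_eq_zero_of_ae (ae_restrict_of_ae ?_)
  exact (ae_restrict_iff' Metric.isOpen_ball.measurableSet).mpr hz

/-! ### Divergence and curl of the cut-off field on one time slice. -/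

theorem integrableOn_ball_mul_continuous {x₀ : Plane} {r : ℝ} {f g : Plane → ℝ}
    (hf : IntegrableOn f (Metric.ball x₀ r)) (hg : Continuous g) :
    IntegrableOn (fun x => f x * g x) (Metric.ball x₀ r) :=
  hf.mul_continuousOn_of_subset hg.continuousOn Metric.isOpen_ball.measurableSet
    (isCompact_closedBall x₀ r) Metric.ball_subset_closedBall

/-- The divergence of `ζ V` for a divergence free field `V`. -/
noncomputable def cutoffDiv (ζ : Plane → ℝ) (V : Plane → Plane) (y : Plane) : ℝ :=
  V y 0 * partialDeriv 0 ζ y + V y 1 * partialDeriv 1 ζ y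

/-- The vorticity of `ζ V` for a field `V` with vorticity `W`. -/
noncomputable def cutoffCurl (ζ : Plane → ℝ) (V : Plane → Plane) (W : Plane → ℝ) (y : Plane) : ℝ :=
  W y * ζ y - (V y 0 * partialDeriv 1 ζ y - V y 1 * partialDeriv 0 ζ y)

theorem integrable_coord {α : Type*} [MeasurableSpace α] {m : Measure α} {V : α → Plane}
    (hV : Integrable V m) (i : Fin 2) : Integrable (fun x => V x i) m :=
  (EuclideanSpace.proj (𝕜 := ℝ) i).integrable_comp hV

theorem integrableOn_cutoffDiv {x₀ : Plane} {r : ℝ} {ζ : Plane → ℝ} (hζ : ContDiff ℝ 1 ζ)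
    {V : Plane → Plane} (hV : IntegrableOn V (Metric.ball x₀ r)) :
    IntegrableOn (cutoffDiv ζ V) (Metric.ball x₀ r) :=
  (integrableOn_ball_mul_continuous (integrable_coord hV 0) (continuous_partialDeriv hζ 0)).add
    (integrableOn_ball_mul_continuous (integrable_coord hV 1) (continuous_partialDeriv hζ 1))

theorem integrableOn_cutoffCurl {x₀ : Plane} {r : ℝ} {ζ : Plane → ℝ} (hζ : ContDiff ℝ 1 ζ)
    {V : Plane → Plane} (hV : IntegrableOn V (Metric.ball x₀ r)) {W : Plane → ℝ}
    (hW : IntegrableOn W (Metric.ball x₀ r)) :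
    IntegrableOn (cutoffCurl ζ V W) (Metric.ball x₀ r) :=
  (integrableOn_ball_mul_continuous hW hζ.continuous).sub
    ((integrableOn_ball_mul_continuous (integrable_coord hV 0) (continuous_partialDeriv hζ 1)).sub
      (integrableOn_ball_mul_continuous (integrable_coord hV 1) (continuous_partialDeriv hζ 0)))

/-- `ψ` is a test function supported in the ball `B_r(x₀)`. -/
def IsBallTest (x₀ : Plane) (r : ℝ) (ψ : Plane → ℝ) : Prop :=
  ContDiff ℝ (⊤ : ℕ∞) ψ ∧ HasCompactSupport ψ ∧ tsupport ψ ⊆ Metric.ball x₀ r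

theorem IsBallTest.contDiff_one {x₀ : Plane} {r : ℝ} {ψ : Plane → ℝ} (h : IsBallTest x₀ r ψ) :
    ContDiff ℝ 1 ψ := h.1.of_le (by exact_mod_cast le_top)

theorem IsBallTest.mul_right {x₀ : Plane} {r : ℝ} {ψ g : Plane → ℝ} (h : IsBallTest x₀ r ψ)
    (hg : ContDiff ℝ (⊤ : ℕ∞) g) : IsBallTest x₀ r (fun y => ψ y * g y) :=
  ⟨h.1.mul hg, h.2.1.mul_right, (tsupport_mul_subset_left).trans h.2.2⟩

/-- `∫ V · ∇ψ = 0`. -/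
def DivTest (x₀ : Plane) (r : ℝ) (V : Plane → Plane) (ψ : Plane → ℝ) : Prop :=
  ∫ x in Metric.ball x₀ r, (V x 0 * partialDeriv 0 ψ x + V x 1 * partialDeriv 1 ψ x) = 0

/-- `∫ W ψ = - ∫ (V₁ ∂₀ψ - V₀ ∂₁ψ)`. -/
def CurlTest (x₀ : Plane) (r : ℝ) (V : Plane → Plane) (W : Plane → ℝ) (ψ : Plane → ℝ) : Prop :=
  ∫ x in Metric.ball x₀ r, W x * ψ x
    = - ∫ x in Metric.ball x₀ r, (V x 1 * partialDeriv 0 ψ x - V x 0 * partialDeriv 1 ψ x)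

section Slice

variable {x₀ : Plane} {r : ℝ} {ζ η : Plane → ℝ} {V : Plane → Plane} {W : Plane → ℝ}

/-- With `P_j = N_j * η`, subtract the curl identity tested with `ζ P₁` from the divergence identity
tested with `ζ P₀`. Derivatives of `ζ` form `cutoffDiv` and the gradient part of `cutoffCurl`.
Derivatives of the potentials form `V₀ζ(∂₀P₀ + ∂₁P₁) = V₀ζη` and `V₁ζ(∂₁P₀ - ∂₀P₁) = 0`. -/
theorem setIntegral_zero_coord_mul_cutoff (hζ : IsBallTest x₀ r ζ) (hη : IsBallTest x₀ r η)
    (hV : IntegrableOn V (Metric.ball x₀ r)) (hW : IntegrableOn W (Metric.ball x₀ r))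
    (hd : DivTest x₀ r V (fun y => ζ y * newtonPotential 0 η y))
    (hc : CurlTest x₀ r V W (fun y => ζ y * newtonPotential 1 η y)) :
    ∫ x in Metric.ball x₀ r, (V x 0 * (ζ x * η x)
      - (cutoffCurl ζ V W x * newtonPotential 1 η x
        - cutoffDiv ζ V x * newtonPotential 0 η x)) = 0 := by
  have hP : ∀ j, ContDiff ℝ 1 (newtonPotential j η) := fun j =>
    (contDiff_newtonPotential j hη.1 hη.2.1).of_le (by exact_mod_cast le_top)
  have hψ : ∀ j, ContDiff ℝ 1 (fun y => ζ y * newtonPotential j η y) := fun j =>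
    hζ.contDiff_one.mul (hP j)
  have i0 := integrableOn_ball_mul_continuous hW (hψ 1).continuous
  have i1 : ∀ i k j, IntegrableOn (fun x => V x i *
      partialDeriv k (fun y => ζ y * newtonPotential j η y) x) (Metric.ball x₀ r) := fun i k j =>
    integrableOn_ball_mul_continuous (integrable_coord hV i) (continuous_partialDeriv (hψ j) k)
  unfold DivTest at hd
  unfold CurlTest at hc
  have key : ∀ x, V x 0 * (ζ x * η x)
      - (cutoffCurl ζ V W x * newtonPotential 1 η x
        - cutoffDiv ζ V x * newtonPotential 0 η x)
      = (V x 0 * partialDeriv 0 (fun y => ζ y * newtonPotential 0 η y) x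
          + V x 1 * partialDeriv 1 (fun y => ζ y * newtonPotential 0 η y) x)
        - (W x * (ζ x * newtonPotential 1 η x)
          + (V x 1 * partialDeriv 0 (fun y => ζ y * newtonPotential 1 η y) x
            - V x 0 * partialDeriv 1 (fun y => ζ y * newtonPotential 1 η y) x)) := by
    intro x
    simp only [partialDeriv_mul hζ.contDiff_one (hP _), cutoffCurl, cutoffDiv]
    rw [← partialDeriv_newtonPotential_add hη.contDiff_one hη.2.1 x,
      partialDeriv_newtonPotential_comm hη.contDiff_one hη.2.1 x]
    ring
  simp only [key]
  rw [integral_sub ((i1 0 0 0).fun_add (i1 1 1 0)) (i0.fun_add ((i1 1 0 1).fun_sub (i1 0 1 1))), hd,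
    integral_add i0 ((i1 1 0 1).fun_sub (i1 0 1 1)), hc]
  simp

/-- The same computation with the two potentials exchanged and the identities added, which isolates
`V₁ζη`. -/
theorem setIntegral_one_coord_mul_cutoff (hζ : IsBallTest x₀ r ζ) (hη : IsBallTest x₀ r η)
    (hV : IntegrableOn V (Metric.ball x₀ r)) (hW : IntegrableOn W (Metric.ball x₀ r))
    (hd : DivTest x₀ r V (fun y => ζ y * newtonPotential 1 η y))
    (hc : CurlTest x₀ r V W (fun y => ζ y * newtonPotential 0 η y)) :
    ∫ x in Metric.ball x₀ r, (V x 1 * (ζ x * η x)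
      + (cutoffCurl ζ V W x * newtonPotential 0 η x
        + cutoffDiv ζ V x * newtonPotential 1 η x)) = 0 := by
  have hP : ∀ j, ContDiff ℝ 1 (newtonPotential j η) := fun j =>
    (contDiff_newtonPotential j hη.1 hη.2.1).of_le (by exact_mod_cast le_top)
  have hψ : ∀ j, ContDiff ℝ 1 (fun y => ζ y * newtonPotential j η y) := fun j =>
    hζ.contDiff_one.mul (hP j)
  have i0 := integrableOn_ball_mul_continuous hW (hψ 0).continuous
  have i1 : ∀ i k j, IntegrableOn (fun x => V x i *
      partialDeriv k (fun y => ζ y * newtonPotential j η y) x) (Metric.ball x₀ r) := fun i k j =>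
    integrableOn_ball_mul_continuous (integrable_coord hV i) (continuous_partialDeriv (hψ j) k)
  unfold DivTest at hd
  unfold CurlTest at hc
  have key : ∀ x, V x 1 * (ζ x * η x)
      + (cutoffCurl ζ V W x * newtonPotential 0 η x
        + cutoffDiv ζ V x * newtonPotential 1 η x)
      = (V x 0 * partialDeriv 0 (fun y => ζ y * newtonPotential 1 η y) x
          + V x 1 * partialDeriv 1 (fun y => ζ y * newtonPotential 1 η y) x)
        + (W x * (ζ x * newtonPotential 0 η x)
          + (V x 1 * partialDeriv 0 (fun y => ζ y * newtonPotential 0 η y) x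
            - V x 0 * partialDeriv 1 (fun y => ζ y * newtonPotential 0 η y) x)) := by
    intro x
    simp only [partialDeriv_mul hζ.contDiff_one (hP _), cutoffCurl, cutoffDiv]
    rw [← partialDeriv_newtonPotential_add hη.contDiff_one hη.2.1 x,
      partialDeriv_newtonPotential_comm hη.contDiff_one hη.2.1 x]
    ring
  simp only [key]
  rw [integral_add ((i1 0 0 1).fun_add (i1 1 1 1)) (i0.fun_add ((i1 1 0 0).fun_sub (i1 0 1 0))), hd,
    integral_add i0 ((i1 1 0 0).fun_sub (i1 0 1 0)), hc]
  simp

end Slice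

/-! ### Biot–Savart representation almost everywhere in space-time. -/

section SpaceTime

variable {x₀ : Plane} {r : ℝ} {ν : Measure ℝ} {ζ : Plane → ℝ}
  {v : Plane × ℝ → Plane} {ω : Plane × ℝ → ℝ}

theorem integrable_prod_mul_continuous {f : Plane × ℝ → ℝ}
    (hf : Integrable f ((volume.restrict (Metric.ball x₀ r)).prod ν)) {g : Plane → ℝ}
    (hg : Continuous g) (hc : HasCompactSupport g) :
    Integrable (fun z => f z * g z.1) ((volume.restrict (Metric.ball x₀ r)).prod ν) := by
  obtain ⟨C, hC⟩ := hg.bounded_above_of_compact_support hc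
  exact hf.mul_bdd (hg.comp continuous_fst).aestronglyMeasurable
    (Eventually.of_forall fun q => hC q.1)

theorem integrable_prod_cutoffDiv (hζ : IsBallTest x₀ r ζ)
    (hv : Integrable v ((volume.restrict (Metric.ball x₀ r)).prod ν)) :
    Integrable (fun z : Plane × ℝ => cutoffDiv ζ (fun y => v (y, z.2)) z.1)
      ((volume.restrict (Metric.ball x₀ r)).prod ν) :=
  (integrable_prod_mul_continuous (integrable_coord hv 0)
      (continuous_partialDeriv hζ.contDiff_one 0) (hasCompactSupport_partialDeriv hζ.2.1 0)).add
    (integrable_prod_mul_continuous (integrable_coord hv 1)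
      (continuous_partialDeriv hζ.contDiff_one 1) (hasCompactSupport_partialDeriv hζ.2.1 1))

theorem integrable_prod_cutoffCurl (hζ : IsBallTest x₀ r ζ)
    (hv : Integrable v ((volume.restrict (Metric.ball x₀ r)).prod ν))
    (hω : Integrable ω ((volume.restrict (Metric.ball x₀ r)).prod ν)) :
    Integrable (fun z : Plane × ℝ =>
      cutoffCurl ζ (fun y => v (y, z.2)) (fun y => ω (y, z.2)) z.1)
      ((volume.restrict (Metric.ball x₀ r)).prod ν) :=
  (integrable_prod_mul_continuous hω hζ.1.continuous hζ.2.1).sub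
    ((integrable_prod_mul_continuous (integrable_coord hv 0)
      (continuous_partialDeriv hζ.contDiff_one 1) (hasCompactSupport_partialDeriv hζ.2.1 1)).sub
    (integrable_prod_mul_continuous (integrable_coord hv 1)
      (continuous_partialDeriv hζ.contDiff_one 0) (hasCompactSupport_partialDeriv hζ.2.1 0)))

/-- `∫_B N_j(y - x) f(y) dy` for the `j`-th component of the Newton kernel. -/
noncomputable def ballPotential (x₀ : Plane) (r : ℝ) (j : Fin 2) (f : Plane → ℝ) (x : Plane) : ℝ :=
  ∫ y in Metric.ball x₀ r, newtonKernel j (y - x) * f y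

theorem integrable_ballPotential [SFinite ν] {f : Plane × ℝ → ℝ}
    (hf : Integrable f ((volume.restrict (Metric.ball x₀ r)).prod ν)) (j : Fin 2) :
    Integrable (fun z : Plane × ℝ => ballPotential x₀ r j (fun y => f (y, z.2)) z.1)
      ((volume.restrict (Metric.ball x₀ r)).prod ν) :=
  (integrable_exchange_kernel hf (locallyIntegrable_newtonKernel j)
    (measurable_newtonKernel j)).integral_prod_left

theorem setIntegral_test_mul_ballPotential {f : Plane → ℝ}
    (hf : IntegrableOn f (Metric.ball x₀ r)) (j : Fin 2) {η : Plane → ℝ} (hη : IsBallTest x₀ r η) :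
    ∫ y in Metric.ball x₀ r, f y * newtonPotential j η y
      = ∫ x in Metric.ball x₀ r, η x * ballPotential x₀ r j f x :=
  setIntegral_mul_newtonPotential hf j hη.1.continuous hη.2.1 hη.2.2

theorem integrableOn_test_mul_ballPotential {f : Plane → ℝ}
    (hf : IntegrableOn f (Metric.ball x₀ r)) (j : Fin 2) {η : Plane → ℝ} (hη : IsBallTest x₀ r η) :
    IntegrableOn (fun x => η x * ballPotential x₀ r j f x) (Metric.ball x₀ r) := by
  have h1 := (integrable_prod_mul_kernel hf measurable_id
    (ae_restrict_mem Metric.isOpen_ball.measurableSet) (locallyIntegrable_newtonKernel j)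
    (measurable_newtonKernel j)).integral_prod_right
  have h2 : IntegrableOn (ballPotential x₀ r j f) (Metric.ball x₀ r) := by
    refine h1.congr (Eventually.of_forall fun x => ?_)
    simp only [ballPotential, id, mul_comm]
  simpa only [mul_comm] using integrableOn_ball_mul_continuous h2 hη.1.continuous

/-- The Biot–Savart representation of the components of `ζ v`. -/
theorem ae_cutoff_representation [SFinite ν] (hζ : IsBallTest x₀ r ζ)
    (hv : Integrable v ((volume.restrict (Metric.ball x₀ r)).prod ν))
    (hω : Integrable ω ((volume.restrict (Metric.ball x₀ r)).prod ν))
    (hd : ∀ ψ, IsBallTest x₀ r ψ → ∀ᵐ t ∂ν, DivTest x₀ r (fun y => v (y, t)) ψ)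
    (hc : ∀ ψ, IsBallTest x₀ r ψ →
      ∀ᵐ t ∂ν, CurlTest x₀ r (fun y => v (y, t)) (fun y => ω (y, t)) ψ) :
    ∀ᵐ z ∂((volume.restrict (Metric.ball x₀ r)).prod ν),
      v z 0 * ζ z.1
        = ballPotential x₀ r 1 (cutoffCurl ζ (fun y => v (y, z.2)) (fun y => ω (y, z.2))) z.1
          - ballPotential x₀ r 0 (cutoffDiv ζ (fun y => v (y, z.2))) z.1 ∧
      v z 1 * ζ z.1
        = - (ballPotential x₀ r 0 (cutoffCurl ζ (fun y => v (y, z.2)) (fun y => ω (y, z.2))) z.1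
          + ballPotential x₀ r 1 (cutoffDiv ζ (fun y => v (y, z.2))) z.1) := by
  have ia := integrable_prod_cutoffCurl hζ hv hω
  have ib := integrable_prod_cutoffDiv hζ hv
  have hvt : ∀ᵐ t ∂ν, IntegrableOn (fun y => v (y, t)) (Metric.ball x₀ r) := hv.prod_left_ae
  have hωt : ∀ᵐ t ∂ν, IntegrableOn (fun y => ω (y, t)) (Metric.ball x₀ r) := hω.prod_left_ae
  have iv : ∀ i, Integrable (fun z => v z i * ζ z.1)
      ((volume.restrict (Metric.ball x₀ r)).prod ν) := fun i =>
    integrable_prod_mul_continuous (integrable_coord hv i) hζ.1.continuous hζ.2.1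
  -- The difference of the two sides is tested against `η` on a slice; once the potentials are moved
  -- back onto `η`, this is the slice identity for coordinate 0.
  have h0 := ae_eq_zero_of_forall_test
    (((iv 0).sub ((integrable_ballPotential ia 1).sub (integrable_ballPotential ib 0))))
    (by
      intro η h1 h2 h3
      have hη : IsBallTest x₀ r η := ⟨h1, h2, h3⟩
      filter_upwards [hvt, hωt,
        hd _ (hζ.mul_right (contDiff_newtonPotential 0 h1 h2)),
        hc _ (hζ.mul_right (contDiff_newtonPotential 1 h1 h2))] with t hvt hωt hdt hct
      have hC := integrableOn_cutoffCurl hζ.contDiff_one hvt hωt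
      have hD := integrableOn_cutoffDiv hζ.contDiff_one hvt
      have hP : ∀ j, Continuous (newtonPotential j η) := fun j =>
        (contDiff_newtonPotential j h1 h2).continuous
      have iV : IntegrableOn (fun x => v (x, t) 0 * (ζ x * η x)) (Metric.ball x₀ r) :=
        integrableOn_ball_mul_continuous (integrable_coord hvt 0)
        (hζ.1.continuous.mul h1.continuous)
      have key := setIntegral_zero_coord_mul_cutoff hζ hη hvt hωt hdt hct
      have jC := integrableOn_ball_mul_continuous hC (hP 1)
      have jD := integrableOn_ball_mul_continuous hD (hP 0)
      rw [integral_sub iV (jC.fun_sub jD), integral_sub jC jD,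
        setIntegral_test_mul_ballPotential hC 1 hη, setIntegral_test_mul_ballPotential hD 0 hη,
        ← integral_sub (integrableOn_test_mul_ballPotential hC 1 hη)
          (integrableOn_test_mul_ballPotential hD 0 hη),
        ← integral_sub iV ((integrableOn_test_mul_ballPotential hC 1 hη).fun_sub
          (integrableOn_test_mul_ballPotential hD 0 hη))] at key
      rw [← key]
      refine integral_congr_ae (Eventually.of_forall fun x => ?_)
      simp only [Pi.sub_apply]
      ring)
  have h1 := ae_eq_zero_of_forall_test
    (((iv 1).add ((integrable_ballPotential ia 0).add (integrable_ballPotential ib 1))))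
    (by
      intro η h1 h2 h3
      have hη : IsBallTest x₀ r η := ⟨h1, h2, h3⟩
      filter_upwards [hvt, hωt,
        hd _ (hζ.mul_right (contDiff_newtonPotential 1 h1 h2)),
        hc _ (hζ.mul_right (contDiff_newtonPotential 0 h1 h2))] with t hvt hωt hdt hct
      have hC := integrableOn_cutoffCurl hζ.contDiff_one hvt hωt
      have hD := integrableOn_cutoffDiv hζ.contDiff_one hvt
      have hP : ∀ j, Continuous (newtonPotential j η) := fun j =>
        (contDiff_newtonPotential j h1 h2).continuous
      have iV : IntegrableOn (fun x => v (x, t) 1 * (ζ x * η x)) (Metric.ball x₀ r) :=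
        integrableOn_ball_mul_continuous (integrable_coord hvt 1)
        (hζ.1.continuous.mul h1.continuous)
      have key := setIntegral_one_coord_mul_cutoff hζ hη hvt hωt hdt hct
      have jC := integrableOn_ball_mul_continuous hC (hP 0)
      have jD := integrableOn_ball_mul_continuous hD (hP 1)
      rw [integral_add iV (jC.fun_add jD), integral_add jC jD,
        setIntegral_test_mul_ballPotential hC 0 hη, setIntegral_test_mul_ballPotential hD 1 hη,
        ← integral_add (integrableOn_test_mul_ballPotential hC 0 hη)
          (integrableOn_test_mul_ballPotential hD 1 hη),
        ← integral_add iV ((integrableOn_test_mul_ballPotential hC 0 hη).fun_add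
          (integrableOn_test_mul_ballPotential hD 1 hη))] at key
      rw [← key]
      refine integral_congr_ae (Eventually.of_forall fun x => ?_)
      simp only [Pi.add_apply]
      ring)
  filter_upwards [h0, h1] with z h0 h1
  simp only [Pi.sub_apply, Pi.add_apply, Pi.zero_apply] at h0 h1
  constructor
  · linarith
  · linarith

end SpaceTime

/-! ### Cutoff functions with quantitative gradient bounds. -/

theorem exists_bound_deriv_smoothTransition :
    ∃ C : ℝ, 0 ≤ C ∧ ∀ x, |deriv Real.smoothTransition x| ≤ C ∧
      ((x < 0 ∨ 1 < x) → deriv Real.smoothTransition x = 0) := by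
  have hout : ∀ x, (x < 0 ∨ 1 < x) → deriv Real.smoothTransition x = 0 := by
    rintro x (hx | hx)
    · have : Real.smoothTransition =ᶠ[𝓝 x] fun _ => 0 := by
        filter_upwards [eventually_lt_nhds hx] with y hy
        exact Real.smoothTransition.zero_of_nonpos hy.le
      rw [this.deriv_eq, deriv_const]
    · have : Real.smoothTransition =ᶠ[𝓝 x] fun _ => 1 := by
        filter_upwards [eventually_gt_nhds hx] with y hy
        exact Real.smoothTransition.one_of_one_le hy.le
      rw [this.deriv_eq, deriv_const]
  have hcont : Continuous (deriv Real.smoothTransition) :=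
    (Real.smoothTransition.contDiff (n := 1)).continuous_deriv le_rfl
  obtain ⟨C, hC⟩ := (isCompact_Icc (a := (0 : ℝ)) (b := 1)).exists_bound_of_continuousOn
    hcont.continuousOn
  have hC0 : 0 ≤ C := (norm_nonneg _).trans (hC 0 ⟨le_rfl, zero_le_one⟩)
  refine ⟨C, hC0, fun x => ⟨?_, hout x⟩⟩
  by_cases hx : x ∈ Icc (0 : ℝ) 1
  · exact hC x hx
  · rw [hout x, abs_zero]
    · exact hC0
    · by_contra h
      push Not at h
      exact hx ⟨h.1, h.2⟩

/-- The constant `M` is universal. The lower bound on `dist y x₀` keeps the kernel singularity at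
points of `σB` away from the gradient of `ζ`. -/
theorem exists_cutoff : ∃ M : ℝ, 0 < M ∧ ∀ (x₀ : Plane) (r σ : ℝ), 0 < r → 0 < σ → σ < 1 →
    ∃ ζ : Plane → ℝ, IsBallTest x₀ r ζ ∧ (∀ y, 0 ≤ ζ y ∧ ζ y ≤ 1) ∧
      (∀ y ∈ Metric.ball x₀ (σ * r), ζ y = 1) ∧
      (∀ i y, |partialDeriv i ζ y| ≤ M / ((1 - σ) * r)) ∧
      ∀ i y, partialDeriv i ζ y ≠ 0 → (2 * σ + 1) / 3 * r ≤ dist y x₀ := by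
  obtain ⟨C, hC0, hC⟩ := exists_bound_deriv_smoothTransition
  -- The chain rule gives `C · 2ρ₂/(ρ₂² - ρ₁²) ≤ 2C/(ρ₂ - ρ₁) = 6C/((1-σ)r)`; the added 1 makes the
  -- constant positive. The radii `ρ₁ < ρ₂` cut the interval from `σr` to `r` into thirds.
  refine ⟨6 * C + 1, by positivity, fun x₀ r σ hr hσ hσ1 => ?_⟩
  set ρ₁ := (2 * σ + 1) / 3 * r with hρ₁
  set ρ₂ := (σ + 2) / 3 * r with hρ₂
  have h1 : 0 < ρ₁ := by positivity
  have h2 : 0 < ρ₂ := by positivity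
  have h12 : ρ₂ - ρ₁ = (1 - σ) * r / 3 := by rw [hρ₁, hρ₂]; ring
  have hσr : 0 < (1 - σ) * r := mul_pos (by linarith) hr
  have h12' : ρ₁ < ρ₂ := by linarith
  have hD : 0 < ρ₂ ^ 2 - ρ₁ ^ 2 := by nlinarith
  -- The squared distance keeps the profile smooth at the centre.
  set A : Plane → ℝ := fun y => (ρ₂ ^ 2 - ‖y - x₀‖ ^ 2) / (ρ₂ ^ 2 - ρ₁ ^ 2) with hA
  set ζ : Plane → ℝ := fun y => Real.smoothTransition (A y) with hζ
  have hAd : ContDiff ℝ (⊤ : ℕ∞) A :=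
    (contDiff_const.sub ((contDiff_id.sub contDiff_const).norm_sq ℝ)).div_const _
  have hA0 : ∀ y, ρ₂ < ‖y - x₀‖ → A y < 0 := by
    intro y hy
    refine div_neg_of_neg_of_pos ?_ hD
    nlinarith
  have hA1 : ∀ y, ‖y - x₀‖ < ρ₁ → 1 < A y := by
    intro y hy
    rw [hA]
    simp only
    rw [lt_div_iff₀ hD]
    nlinarith [norm_nonneg (y - x₀)]
  have hsupp : tsupport ζ ⊆ Metric.closedBall x₀ ρ₂ := by
    refine closure_minimal (fun y hy => ?_) Metric.isClosed_closedBall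
    by_contra hc
    rw [Metric.mem_closedBall, dist_eq_norm, not_le] at hc
    exact hy (Real.smoothTransition.zero_of_nonpos (hA0 y hc).le)
  have hpd : ∀ i y, partialDeriv i ζ y
      = deriv Real.smoothTransition (A y) * (-(2 * (y - x₀) i) / (ρ₂ ^ 2 - ρ₁ ^ 2)) := by
    intro i y
    have e1 : HasFDerivAt (fun y : Plane => ‖y - x₀‖ ^ 2) _ y :=
      ((hasFDerivAt_id y).sub_const x₀).norm_sq
    have e2 := ((e1.const_sub (ρ₂ ^ 2)).mul_const (ρ₂ ^ 2 - ρ₁ ^ 2)⁻¹)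
    have e3 : HasFDerivAt A _ y := e2
    have e4 : HasDerivAt Real.smoothTransition (deriv Real.smoothTransition (A y)) (A y) :=
      ((Real.smoothTransition.contDiff (n := 1)).differentiable one_ne_zero _).hasDerivAt
    have e5 : HasFDerivAt ζ _ y := e4.comp_hasFDerivAt y e3
    rw [partialDeriv, e5.fderiv]
    simp [EuclideanSpace.inner_single_right]
    ring
  refine ⟨ζ, ⟨Real.smoothTransition.contDiff.comp hAd,
    HasCompactSupport.of_support_subset_isCompact (isCompact_closedBall x₀ ρ₂)
      ((subset_tsupport _).trans hsupp), hsupp.trans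
        (Metric.closedBall_subset_ball (by rw [hρ₂]; nlinarith))⟩,
    fun y => ⟨Real.smoothTransition.nonneg _, Real.smoothTransition.le_one _⟩, ?_, ?_, ?_⟩
  · intro y hy
    rw [Metric.mem_ball, dist_eq_norm] at hy
    exact Real.smoothTransition.one_of_one_le (hA1 y (by rw [hρ₁]; nlinarith)).le
  · intro i y
    rw [hpd, abs_mul]
    by_cases hy : ρ₂ < ‖y - x₀‖
    · rw [(hC _).2 (Or.inl (hA0 y hy)), abs_zero, zero_mul]
      positivity
    · have h3 : |(y - x₀) i| ≤ ρ₂ := (PiLp.norm_apply_le (y - x₀) i).trans (not_lt.mp hy)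
      have h4 : |-(2 * (y - x₀) i) / (ρ₂ ^ 2 - ρ₁ ^ 2)| ≤ 6 / ((1 - σ) * r) := by
        rw [abs_div, abs_of_pos hD, abs_neg, abs_mul, abs_two, div_le_div_iff₀ hD hσr]
        have h5 : (1 - σ) * r = 3 * (ρ₂ - ρ₁) := by rw [h12]; ring
        rw [h5]
        nlinarith
      calc _ ≤ C * (6 / ((1 - σ) * r)) := mul_le_mul (hC _).1 h4 (abs_nonneg _) hC0
        _ = 6 * C / ((1 - σ) * r) := by ring
        _ ≤ _ := by gcongr; linarith
  · intro i y hy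
    by_contra hc
    rw [not_le, dist_eq_norm] at hc
    exact hy (by rw [hpd, (hC _).2 (Or.inr (hA1 y hc)), zero_mul])

/-! ### Pointwise bounds on the representation. -/

theorem norm_sq_plane (w : Plane) : ‖w‖ ^ 2 = w 0 ^ 2 + w 1 ^ 2 := by
  rw [EuclideanSpace.norm_sq_eq]
  simp

theorem newtonKernel_sq_add_sq (z : Plane) :
    newtonKernel 0 z ^ 2 + newtonKernel 1 z ^ 2 = (1 / (2 * Real.pi) * ‖z‖⁻¹) ^ 2 := by
  rcases eq_or_ne z 0 with rfl | hz
  · simp [newtonKernel]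
  have hz' : ‖z‖ ≠ 0 := norm_ne_zero_iff.mpr hz
  have hpi := Real.pi_ne_zero
  simp only [newtonKernel, div_pow]
  rw [← add_div, ← norm_sq_plane]
  field_simp

/-- Cauchy–Schwarz in Lagrange's form: the defect is the square of the cross term. Bounding the
vector pairing at once, not by components, preserves the constant `1/(2π)`. -/
theorem abs_inner_newtonKernel_le (w z : Plane) :
    |w 0 * newtonKernel 0 z + w 1 * newtonKernel 1 z| ≤ ‖w‖ * (1 / (2 * Real.pi) * ‖z‖⁻¹) := by
  have hpi := Real.pi_pos
  refine abs_le_of_sq_le_sq ?_ (by positivity)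
  rw [mul_pow, ← newtonKernel_sq_add_sq, norm_sq_plane]
  nlinarith [sq_nonneg (w 0 * newtonKernel 1 z - w 1 * newtonKernel 0 z)]

theorem abs_cross_newtonKernel_le (w z : Plane) :
    |w 0 * newtonKernel 1 z - w 1 * newtonKernel 0 z| ≤ ‖w‖ * (1 / (2 * Real.pi) * ‖z‖⁻¹) := by
  have hpi := Real.pi_pos
  refine abs_le_of_sq_le_sq ?_ (by positivity)
  rw [mul_pow, ← newtonKernel_sq_add_sq, norm_sq_plane]
  nlinarith [sq_nonneg (w 0 * newtonKernel 0 z + w 1 * newtonKernel 1 z)]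

/-- The pointwise bound behind the estimate of the Biot–Savart representation. -/
theorem abs_representation_integrand_le {ζ : Plane → ℝ} {V : Plane → Plane} {W : Plane → ℝ}
    {G d : ℝ} (hd : 0 < d) (h01 : ∀ y, 0 ≤ ζ y ∧ ζ y ≤ 1)
    (hG : ∀ i y, |partialDeriv i ζ y| ≤ G) {x w : Plane}
    (hx : ∀ i y, partialDeriv i ζ y ≠ 0 → d ≤ ‖y - x‖) (y : Plane) :
    |(w 0 * newtonKernel 1 (y - x) - w 1 * newtonKernel 0 (y - x)) * cutoffCurl ζ V W y
      - (w 0 * newtonKernel 0 (y - x) + w 1 * newtonKernel 1 (y - x)) * cutoffDiv ζ V y|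
    ≤ ‖w‖ * (1 / (2 * Real.pi) * (|W y| / ‖x - y‖) + 2 * G / (Real.pi * d) * ‖V y‖) := by
  have hpi := Real.pi_pos
  have hG0 : 0 ≤ G := (abs_nonneg _).trans (hG 0 y)
  set κ := 1 / (2 * Real.pi) * ‖y - x‖⁻¹ with hκ
  have hκ0 : 0 ≤ κ := by positivity
  have e1 := abs_cross_newtonKernel_le w (y - x)
  have e2 := abs_inner_newtonKernel_le w (y - x)
  have hV0 : |V y 0| ≤ ‖V y‖ := PiLp.norm_apply_le (V y) 0
  have hV1 : |V y 1| ≤ ‖V y‖ := PiLp.norm_apply_le (V y) 1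
  -- Where `∂ζ ≠ 0` the kernel is at most `1/(2πd)`. Four products of a component of `V` with a
  -- derivative of `ζ` occur below, two in the curl and two in the divergence, whence the factor `4
  -- · G/(2πd) = 2G/(πd)`.
  have hlow : ∀ i, κ * |partialDeriv i ζ y| ≤ G / (2 * Real.pi * d) := by
    intro i
    by_cases h : partialDeriv i ζ y = 0
    · rw [h, abs_zero, mul_zero]; positivity
    · have h3 : κ ≤ 1 / (2 * Real.pi) * d⁻¹ := by
        rw [hκ]
        gcongr
        exact hx i y h
      calc κ * |partialDeriv i ζ y| ≤ (1 / (2 * Real.pi) * d⁻¹) * G :=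
            mul_le_mul h3 (hG i y) (abs_nonneg _) (by positivity)
        _ = _ := by field_simp
  have hprod : ∀ i j, κ * |V y i * partialDeriv j ζ y| ≤ G / (2 * Real.pi * d) * ‖V y‖ := by
    intro i j
    have hVi : |V y i| ≤ ‖V y‖ := PiLp.norm_apply_le (V y) i
    rw [abs_mul]
    calc κ * (|V y i| * |partialDeriv j ζ y|) = (κ * |partialDeriv j ζ y|) * |V y i| := by ring
      _ ≤ _ := mul_le_mul (hlow j) hVi (abs_nonneg _) (by positivity)
  have hcurl : κ * |cutoffCurl ζ V W y| ≤ κ * |W y| + 2 * (G / (2 * Real.pi * d) * ‖V y‖) := by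
    have h1 : |cutoffCurl ζ V W y| ≤ |W y| + (|V y 0 * partialDeriv 1 ζ y|
        + |V y 1 * partialDeriv 0 ζ y|) := by
      unfold cutoffCurl
      refine (abs_sub _ _).trans (add_le_add ?_ (abs_sub _ _))
      rw [abs_mul, abs_of_nonneg (h01 y).1]
      exact mul_le_of_le_one_right (abs_nonneg _) (h01 y).2
    have h2 := mul_le_mul_of_nonneg_left h1 hκ0
    have h3 := hprod 0 1
    have h4 := hprod 1 0
    linarith
  have hdiv : κ * |cutoffDiv ζ V y| ≤ 2 * (G / (2 * Real.pi * d) * ‖V y‖) := by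
    have h1 : |cutoffDiv ζ V y| ≤ |V y 0 * partialDeriv 0 ζ y| + |V y 1 * partialDeriv 1 ζ y| :=
      abs_add_le _ _
    have h2 := mul_le_mul_of_nonneg_left h1 hκ0
    have h3 := hprod 0 0
    have h4 := hprod 1 1
    linarith
  refine (abs_sub _ _).trans ?_
  rw [abs_mul, abs_mul]
  calc _ ≤ ‖w‖ * κ * |cutoffCurl ζ V W y| + ‖w‖ * κ * |cutoffDiv ζ V y| := by gcongr
    _ = ‖w‖ * (κ * |cutoffCurl ζ V W y| + κ * |cutoffDiv ζ V y|) := by ring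
    _ ≤ ‖w‖ * (κ * |W y| + 2 * (G / (2 * Real.pi * d) * ‖V y‖)
          + 2 * (G / (2 * Real.pi * d) * ‖V y‖)) := by
        gcongr ‖w‖ * ?_
        linarith
    _ = _ := by
      rw [hκ, norm_sub_rev y x]
      field_simp
      ring

/-- Pairing the representation with `w` writes `‖w‖²` as one integral bounded by `‖w‖` times the
right side; one then divides by `‖w‖`. -/
theorem norm_le_of_representation {x₀ : Plane} {r : ℝ} {ζ : Plane → ℝ} {V : Plane → Plane}
    {W : Plane → ℝ} {G d : ℝ} (hd : 0 < d) (h01 : ∀ y, 0 ≤ ζ y ∧ ζ y ≤ 1)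
    (hG : ∀ i y, |partialDeriv i ζ y| ≤ G) {x w : Plane}
    (hx : ∀ i y, partialDeriv i ζ y ≠ 0 → d ≤ ‖y - x‖)
    (hW : IntegrableOn (fun y => |W y| / ‖x - y‖) (Metric.ball x₀ r))
    (hV : IntegrableOn V (Metric.ball x₀ r))
    (a0 : IntegrableOn (fun y => newtonKernel 0 (y - x) * cutoffCurl ζ V W y) (Metric.ball x₀ r))
    (a1 : IntegrableOn (fun y => newtonKernel 1 (y - x) * cutoffCurl ζ V W y) (Metric.ball x₀ r))
    (b0 : IntegrableOn (fun y => newtonKernel 0 (y - x) * cutoffDiv ζ V y) (Metric.ball x₀ r))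
    (b1 : IntegrableOn (fun y => newtonKernel 1 (y - x) * cutoffDiv ζ V y) (Metric.ball x₀ r))
    (r0 : w 0 = ballPotential x₀ r 1 (cutoffCurl ζ V W) x - ballPotential x₀ r 0 (cutoffDiv ζ V) x)
    (r1 : w 1 = -(ballPotential x₀ r 0 (cutoffCurl ζ V W) x
      + ballPotential x₀ r 1 (cutoffDiv ζ V) x)) :
    ‖w‖ ≤ 1 / (2 * Real.pi) * (∫ y in Metric.ball x₀ r, |W y| / ‖x - y‖)
      + 2 * G / (Real.pi * d) * ∫ y in Metric.ball x₀ r, ‖V y‖ := by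
  have hsq : ∫ y in Metric.ball x₀ r,
      ((w 0 * newtonKernel 1 (y - x) - w 1 * newtonKernel 0 (y - x)) * cutoffCurl ζ V W y
      - (w 0 * newtonKernel 0 (y - x) + w 1 * newtonKernel 1 (y - x)) * cutoffDiv ζ V y)
      = ‖w‖ ^ 2 := by
    have e : ∀ y, ((w 0 * newtonKernel 1 (y - x) - w 1 * newtonKernel 0 (y - x))
        * cutoffCurl ζ V W y
      - (w 0 * newtonKernel 0 (y - x) + w 1 * newtonKernel 1 (y - x)) * cutoffDiv ζ V y)
      = w 0 * (newtonKernel 1 (y - x) * cutoffCurl ζ V W y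
          - newtonKernel 0 (y - x) * cutoffDiv ζ V y)
        - w 1 * (newtonKernel 0 (y - x) * cutoffCurl ζ V W y
          + newtonKernel 1 (y - x) * cutoffDiv ζ V y) := fun y => by ring
    simp only [e]
    rw [integral_sub ((a1.fun_sub b0).const_mul _) ((a0.fun_add b1).const_mul _),
      integral_const_mul, integral_const_mul, integral_sub a1 b0, integral_add a0 b1,
      norm_sq_plane]
    unfold ballPotential at r0 r1
    rw [← r0, ← neg_eq_iff_eq_neg.mpr r1]
    ring
  have hint : IntegrableOn (fun y => ‖w‖ * (1 / (2 * Real.pi) * (|W y| / ‖x - y‖)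
      + 2 * G / (Real.pi * d) * ‖V y‖)) (Metric.ball x₀ r) :=
    ((hW.const_mul _).fun_add (hV.norm.const_mul _)).const_mul _
  have hbound := norm_integral_le_of_norm_le hint (Eventually.of_forall fun y =>
    (Real.norm_eq_abs _).trans_le
      (abs_representation_integrand_le (V := V) (W := W) (w := w) hd h01 hG hx y))
  rw [hsq, integral_const_mul, integral_add (hW.const_mul _) (hV.norm.const_mul _),
    integral_const_mul, integral_const_mul] at hbound
  replace hbound := (le_abs_self _).trans hbound
  rcases (norm_nonneg w).eq_or_lt with h0 | h0
  · rw [← h0]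
    have hpi := Real.pi_pos
    have hG0 : 0 ≤ G := (abs_nonneg _).trans (hG 0 0)
    have i1 : 0 ≤ ∫ y in Metric.ball x₀ r, |W y| / ‖x - y‖ :=
      integral_nonneg fun y => by positivity
    have i2 : 0 ≤ ∫ y in Metric.ball x₀ r, ‖V y‖ := integral_nonneg fun y => norm_nonneg _
    exact add_nonneg (mul_nonneg (by positivity) i1) (mul_nonneg (by positivity) i2)
  · rw [sq] at hbound
    exact le_of_mul_le_mul_left hbound h0

section SpaceTime

variable {x₀ : Plane} {r : ℝ} {ν : Measure ℝ} [SFinite ν] {ζ : Plane → ℝ}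
  {v : Plane × ℝ → Plane} {ω : Plane × ℝ → ℝ}

theorem ae_integrableOn_vorticity_div_norm
    (hω : Integrable ω ((volume.restrict (Metric.ball x₀ r)).prod ν)) :
    ∀ᵐ z ∂((volume.restrict (Metric.ball x₀ r)).prod ν),
      IntegrableOn (fun y => |ω (y, z.2)| / ‖z.1 - y‖) (Metric.ball x₀ r) := by
  have h := (integrable_exchange_kernel hω.norm locallyIntegrable_norm_inv
    (by fun_prop : Measurable fun z : Plane => ‖z‖⁻¹)).prod_right_ae
  filter_upwards [h] with z hz
  refine hz.congr (Eventually.of_forall fun y => ?_)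
  simp only [Real.norm_eq_abs]
  rw [norm_sub_rev, div_eq_inv_mul]

theorem ae_integrableOn_newtonKernel_mul {f : Plane × ℝ → ℝ}
    (hf : Integrable f ((volume.restrict (Metric.ball x₀ r)).prod ν)) (j : Fin 2) :
    ∀ᵐ z ∂((volume.restrict (Metric.ball x₀ r)).prod ν),
      IntegrableOn (fun y => newtonKernel j (y - z.1) * f (y, z.2)) (Metric.ball x₀ r) :=
  (integrable_exchange_kernel hf (locallyIntegrable_newtonKernel j)
    (measurable_newtonKernel j)).prod_right_ae

theorem ae_slice_integrableOn {E : Type*} [NormedAddCommGroup E] {f : Plane × ℝ → E}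
    (hf : Integrable f ((volume.restrict (Metric.ball x₀ r)).prod ν)) :
    ∀ᵐ z ∂((volume.restrict (Metric.ball x₀ r)).prod ν),
      IntegrableOn (fun y => f (y, z.2)) (Metric.ball x₀ r) :=
  Measure.quasiMeasurePreserving_snd.ae hf.prod_left_ae

theorem ae_norm_le_of_cutoff (hζ : IsBallTest x₀ r ζ) (h01 : ∀ y, 0 ≤ ζ y ∧ ζ y ≤ 1) {G d : ℝ}
    (hd0 : 0 < d) (hG : ∀ i y, |partialDeriv i ζ y| ≤ G)
    (hv : Integrable v ((volume.restrict (Metric.ball x₀ r)).prod ν))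
    (hω : Integrable ω ((volume.restrict (Metric.ball x₀ r)).prod ν))
    (hd : ∀ ψ, IsBallTest x₀ r ψ → ∀ᵐ t ∂ν, DivTest x₀ r (fun y => v (y, t)) ψ)
    (hc : ∀ ψ, IsBallTest x₀ r ψ →
      ∀ᵐ t ∂ν, CurlTest x₀ r (fun y => v (y, t)) (fun y => ω (y, t)) ψ) :
    ∀ᵐ z ∂((volume.restrict (Metric.ball x₀ r)).prod ν),
      ζ z.1 = 1 → (∀ i y, partialDeriv i ζ y ≠ 0 → d ≤ ‖y - z.1‖) →
      ‖v z‖ ≤ 1 / (2 * Real.pi) * (∫ y in Metric.ball x₀ r, |ω (y, z.2)| / ‖z.1 - y‖)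
        + 2 * G / (Real.pi * d) * ∫ y in Metric.ball x₀ r, ‖v (y, z.2)‖ := by
  filter_upwards [ae_cutoff_representation hζ hv hω hd hc, ae_integrableOn_vorticity_div_norm hω,
    ae_slice_integrableOn hv,
    ae_integrableOn_newtonKernel_mul (integrable_prod_cutoffCurl hζ hv hω) 0,
    ae_integrableOn_newtonKernel_mul (integrable_prod_cutoffCurl hζ hv hω) 1,
    ae_integrableOn_newtonKernel_mul (integrable_prod_cutoffDiv hζ hv) 0,
    ae_integrableOn_newtonKernel_mul (integrable_prod_cutoffDiv hζ hv) 1]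
    with z hrep hωz hvz a0 a1 b0 b1 hz1 hzd
  rw [hz1, mul_one, mul_one] at hrep
  exact norm_le_of_representation hd0 h01 hG hzd hωz hvz a0 a1 b0 b1 hrep.1 hrep.2

end SpaceTime

/-! ### The interior estimate. -/

theorem volume_real_ball_plane (x : Plane) {r : ℝ} (hr : 0 ≤ r) :
    volume.real (Metric.ball x r) = Real.pi * r ^ 2 := by
  rw [measureReal_def, EuclideanSpace.volume_ball_fin_two, ENNReal.toReal_mul, ENNReal.toReal_pow,
    ENNReal.toReal_ofReal hr, ENNReal.toReal_ofReal Real.pi_pos.le, mul_comm]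

/-- The interior estimate for a divergence free field in terms of its vorticity. -/
theorem exists_interior_estimate : ∃ C : ℝ, 0 < C ∧ ∀ (x₀ : Plane) (r σ : ℝ) (ν : Measure ℝ)
    [SFinite ν] (v : Plane × ℝ → Plane) (ω : Plane × ℝ → ℝ), 0 < r → 0 < σ → σ < 1 →
    Integrable v ((volume.restrict (Metric.ball x₀ r)).prod ν) →
    Integrable ω ((volume.restrict (Metric.ball x₀ r)).prod ν) →
    (∀ ψ, IsBallTest x₀ r ψ → ∀ᵐ t ∂ν, DivTest x₀ r (fun y => v (y, t)) ψ) →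
    (∀ ψ, IsBallTest x₀ r ψ →
      ∀ᵐ t ∂ν, CurlTest x₀ r (fun y => v (y, t)) (fun y => ω (y, t)) ψ) →
    ∀ᵐ z ∂((volume.restrict (Metric.ball x₀ r)).prod ν), z.1 ∈ Metric.ball x₀ (σ * r) →
      ‖v z‖ ≤ 1 / (2 * Real.pi) * (∫ y in Metric.ball x₀ r, |ω (y, z.2)| / ‖z.1 - y‖)
        + C / (1 - σ) ^ 3 * ⨍ y in Metric.ball x₀ r, ‖v (y, z.2)‖ := by
  obtain ⟨M, hM, hcut⟩ := exists_cutoff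
  -- With `G = M/((1-σ)r)` and `d = (1-σ)r/3`, the factor `2G/(πd)` equals `6M(1-σ)⁻²/|B|`. The
  -- power 2 is weakened to 3 at the end, as `1 - σ ≤ 1`.
  refine ⟨6 * M, by positivity, fun x₀ r σ ν _ v ω hr hσ hσ1 hv hω hd hc => ?_⟩
  obtain ⟨ζ, hζ, h01, h1, hG, hlow⟩ := hcut x₀ r σ hr hσ hσ1
  have hs : 0 < 1 - σ := by linarith
  filter_upwards [ae_norm_le_of_cutoff hζ h01 (d := (1 - σ) * r / 3) (by positivity) hG hv hω hd hc]
    with z hz hzσ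
  refine (hz (h1 _ hzσ) fun i y hy => ?_).trans ?_
  · have h2 := hlow i y hy
    rw [Metric.mem_ball] at hzσ
    have h3 := dist_triangle y z.1 x₀
    rw [← dist_eq_norm]
    nlinarith
  · have hpi := Real.pi_pos
    refine add_le_add le_rfl ?_
    rw [setAverage_eq, volume_real_ball_plane _ hr.le, smul_eq_mul]
    have i2 : 0 ≤ ∫ y in Metric.ball x₀ r, ‖v (y, z.2)‖ := integral_nonneg fun y => norm_nonneg _
    rw [← mul_assoc]
    refine mul_le_mul_of_nonneg_right ?_ i2
    have e : 2 * (M / ((1 - σ) * r)) / (Real.pi * ((1 - σ) * r / 3))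
        = 6 * M / (1 - σ) ^ 2 * (Real.pi * r ^ 2)⁻¹ := by
      field_simp
      ring
    rw [e]
    gcongr ?_ * _
    refine div_le_div_of_nonneg_left (by positivity) (by positivity) ?_
    exact pow_le_pow_of_le_one hs.le (by linarith) (by norm_num)

/-! ### From the weak formulation on `Ω_T` to almost every time slice. -/

section Geometry

variable {Ω : Set Plane} {T t₀ r : ℝ} {x₀ : Plane}

theorem closure_cyl (x₀ : Plane) (t₀ : ℝ) {r : ℝ} (hr : 0 < r) :
    closure (cyl x₀ t₀ r) = Metric.closedBall x₀ r ×ˢ Icc (t₀ - r) t₀ := by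
  rw [cyl, closure_prod_eq, closure_ball _ hr.ne', closure_Ioo (by linarith)]

theorem ball_subset_of_closure_cyl_subset (hr : 0 < r)
    (h : closure (cyl x₀ t₀ r) ⊆ spaceTime Ω T) : Metric.ball x₀ r ⊆ Ω := by
  intro x hx
  have : (x, t₀) ∈ closure (cyl x₀ t₀ r) := by
    rw [closure_cyl x₀ t₀ hr]
    exact ⟨Metric.ball_subset_closedBall hx, by linarith, le_rfl⟩
  exact (h this).1

theorem Ioo_subset_of_closure_cyl_subset (hr : 0 < r)
    (h : closure (cyl x₀ t₀ r) ⊆ spaceTime Ω T) : Ioo (t₀ - r) t₀ ⊆ Ioo 0 T := by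
  have h1 : (x₀, t₀) ∈ closure (cyl x₀ t₀ r) := by
    rw [closure_cyl x₀ t₀ hr]
    exact ⟨Metric.mem_closedBall_self hr.le, by linarith, le_rfl⟩
  have h2 : (x₀, t₀ - r) ∈ closure (cyl x₀ t₀ r) := by
    rw [closure_cyl x₀ t₀ hr]
    exact ⟨Metric.mem_closedBall_self hr.le, le_rfl, by linarith⟩
  exact Ioo_subset_Ioo (h h2).2.1.le (h h1).2.2

theorem integrable_cyl_of_memL2Loc {F : Type*} [NormedAddCommGroup F] {f : Plane × ℝ → F}
    (hr : 0 < r) (h : closure (cyl x₀ t₀ r) ⊆ spaceTime Ω T) (hf : MemL2Loc Ω T f) :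
    Integrable f
      ((volume.restrict (Metric.ball x₀ r)).prod (volume.restrict (Ioo (t₀ - r) t₀))) := by
  have hK : IsCompact (closure (cyl x₀ t₀ r)) := by
    rw [closure_cyl x₀ t₀ hr]
    exact (isCompact_closedBall _ _).prod isCompact_Icc
  have : IsFiniteMeasure (volume.restrict (closure (cyl x₀ t₀ r))) :=
    ⟨by simpa using hK.measure_lt_top⟩
  have h1 : IntegrableOn f (closure (cyl x₀ t₀ r)) :=
    (hf _ hK h).integrable (by norm_num)
  rw [Measure.prod_restrict]
  exact h1.mono_set subset_closure

end Geometry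

section Div

variable {Ω : Set Plane} {T r : ℝ} {x₀ : Plane} {u : Plane × ℝ → Plane} {ψ : Plane → ℝ}

theorem continuous_gradient (hψ : ContDiff ℝ 1 ψ) : Continuous (gradient ψ) :=
  (InnerProductSpace.toDual ℝ Plane).symm.continuous.comp (hψ.continuous_fderiv one_ne_zero)

theorem hasCompactSupport_gradient (hc : HasCompactSupport ψ) : HasCompactSupport (gradient ψ) :=
  (hc.fderiv ℝ).comp_left (map_zero (InnerProductSpace.toDual ℝ Plane).symm)

theorem inner_gradient_eq (w x : Plane) :
    inner ℝ w (gradient ψ x) = w 0 * partialDeriv 0 ψ x + w 1 * partialDeriv 1 ψ x := by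
  rw [← fderiv_eq_partialDeriv, real_inner_comm, gradient, InnerProductSpace.toDual_symm_apply]

theorem IsBallTest.memH10 (hψ : IsBallTest x₀ r ψ) (hΩ : Metric.ball x₀ r ⊆ Ω) :
    MemH10 Ω ψ (gradient ψ) := by
  refine ⟨(hψ.1.continuous.memLp_of_hasCompactSupport hψ.2.1).restrict _,
    ((continuous_gradient hψ.contDiff_one).memLp_of_hasCompactSupport
      (hasCompactSupport_gradient hψ.2.1)).restrict _,
    fun _ => ψ, fun _ => ⟨hψ.1, hψ.2.1, hψ.2.2.trans hΩ⟩, ?_, ?_⟩ <;> simp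

theorem IsBallTest.partialDeriv_eq_zero (hψ : IsBallTest x₀ r ψ) {x : Plane}
    (hx : x ∉ Metric.ball x₀ r) (i : Fin 2) : partialDeriv i ψ x = 0 := by
  have := notMem_subset (tsupport_fderiv_subset ℝ (f := ψ)) (fun h => hx (hψ.2.2 h))
  simp [partialDeriv, image_eq_zero_of_notMem_tsupport this]

theorem IsBallTest.eq_zero (hψ : IsBallTest x₀ r ψ) {x : Plane}
    (hx : x ∉ Metric.ball x₀ r) : ψ x = 0 :=
  image_eq_zero_of_notMem_tsupport fun h => hx (hψ.2.2 h)

/-- The identity in `divFree` is conditional on integrability over `Ω`. This holds here because the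
gradient of `ψ` is bounded and vanishes off the ball, where almost every slice of `u` is integrable.
-/
theorem ae_divTest {J : Set ℝ} (hΩo : IsOpen Ω) (hu : IsWeakSolution Ω T u)
    (hΩ : Metric.ball x₀ r ⊆ Ω) (hJ : J ⊆ Ioo 0 T)
    (hui : Integrable u ((volume.restrict (Metric.ball x₀ r)).prod (volume.restrict J)))
    (hψ : IsBallTest x₀ r ψ) :
    ∀ᵐ t ∂(volume.restrict J), DivTest x₀ r (fun y => u (y, t)) ψ := by
  have h1 := ae_restrict_of_ae_restrict_of_subset (hJ.trans Ioo_subset_Icc_self)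
    (hu.divFree ψ (gradient ψ) (hψ.memH10 hΩ))
  have h2 : ∀ᵐ t ∂(volume.restrict J), IntegrableOn (fun y => u (y, t)) (Metric.ball x₀ r) :=
    hui.prod_left_ae
  filter_upwards [h1, h2] with t h1 h2
  simp only [inner_gradient_eq] at h1
  have hzero : ∀ x ∈ Ω \ Metric.ball x₀ r,
      u (x, t) 0 * partialDeriv 0 ψ x + u (x, t) 1 * partialDeriv 1 ψ x = 0 := by
    intro x hx
    simp [hψ.partialDeriv_eq_zero hx.2]
  have h3 := h1 (IntegrableOn.of_forall_sdiff_eq_zero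
    (integrableOn_cutoffDiv hψ.contDiff_one h2) hΩo.measurableSet hzero)
  rw [DivTest, ← h3]
  exact (setIntegral_eq_of_subset_of_forall_sdiff_eq_zero hΩo.measurableSet hΩ hzero).symm

end Div

section Curl

variable {Ω : Set Plane} {T r : ℝ} {x₀ : Plane} {u : Plane × ℝ → Plane} {ω : Plane × ℝ → ℝ}
  {ψ : Plane → ℝ} {θ : ℝ → ℝ}

theorem spatialDeriv_tensor (hψ : ContDiff ℝ 1 ψ) (hθ : ContDiff ℝ 1 θ) (i : Fin 2)
    (z : Plane × ℝ) :
    spatialDeriv i (fun z : Plane × ℝ => ψ z.1 * θ z.2) z = partialDeriv i ψ z.1 * θ z.2 := by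
  have h1 : HasFDerivAt (fun z : Plane × ℝ => ψ z.1) _ z :=
    ((hψ.differentiable one_ne_zero) z.1).hasFDerivAt.comp z hasFDerivAt_fst
  have h2 : HasFDerivAt (fun z : Plane × ℝ => θ z.2) _ z :=
    ((hθ.differentiable one_ne_zero) z.2).hasFDerivAt.comp z hasFDerivAt_snd
  have h3 : HasFDerivAt (fun z : Plane × ℝ => ψ z.1 * θ z.2) _ z := h1.mul h2
  rw [spatialDeriv, h3.fderiv]
  simp [partialDeriv, mul_comm]

theorem IsBallTest.isTestFunction_tensor (hψ : IsBallTest x₀ r ψ) (hΩ : Metric.ball x₀ r ⊆ Ω)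
    (hθ : ContDiff ℝ (⊤ : ℕ∞) θ) (hc : HasCompactSupport θ) (hs : tsupport θ ⊆ Ioo 0 T) :
    IsTestFunction Ω T (fun z : Plane × ℝ => ψ z.1 * θ z.2) := by
  have hsub : Function.support (fun z : Plane × ℝ => ψ z.1 * θ z.2)
      ⊆ tsupport ψ ×ˢ tsupport θ := fun z hz =>
    ⟨subset_tsupport _ (left_ne_zero_of_mul hz), subset_tsupport _ (right_ne_zero_of_mul hz)⟩
  refine ⟨(hψ.1.comp contDiff_fst).mul (hθ.comp contDiff_snd),
    HasCompactSupport.of_support_subset_isCompact (hψ.2.1.isCompact.prod hc.isCompact) hsub, ?_⟩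
  exact (closure_minimal hsub ((isClosed_tsupport _).prod (isClosed_tsupport _))).trans
    (prod_mono (hψ.2.2.trans hΩ) hs)

/-- Integrals over `Ω_T` of functions `f(x, t) θ(t)` with `f(·, t)` supported in a ball. -/
theorem setIntegral_spaceTime_mul {J : Set ℝ} (hΩo : IsOpen Ω)
    (hΩ : Metric.ball x₀ r ⊆ Ω) (hJ : J ⊆ Ioo 0 T) {f : Plane × ℝ → ℝ}
    (hf : Integrable f ((volume.restrict (Metric.ball x₀ r)).prod (volume.restrict J)))
    (hf0 : ∀ z : Plane × ℝ, z.1 ∉ Metric.ball x₀ r → f z = 0)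
    (hθ : Continuous θ) (hc : HasCompactSupport θ) (hs : tsupport θ ⊆ J) :
    ∫ z in spaceTime Ω T, f z * θ z.2
      = ∫ t in J, θ t * ∫ x in Metric.ball x₀ r, f (x, t) := by
  have hsub : Metric.ball x₀ r ×ˢ J ⊆ spaceTime Ω T :=
    prod_mono hΩ (hJ.trans Ioo_subset_Ioc_self)
  have h1 : ∫ z in Metric.ball x₀ r ×ˢ J, f z * θ z.2 = ∫ z in spaceTime Ω T, f z * θ z.2 := by
    refine (setIntegral_eq_of_subset_of_forall_sdiff_eq_zero
      (hΩo.measurableSet.prod measurableSet_Ioc) hsub ?_).symm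
    rintro z ⟨-, hz⟩
    by_cases hx : z.1 ∈ Metric.ball x₀ r
    · have ht : z.2 ∉ tsupport θ := fun h => hz ⟨hx, hs h⟩
      rw [image_eq_zero_of_notMem_tsupport ht, mul_zero]
    · rw [hf0 z hx, zero_mul]
  obtain ⟨C, hC⟩ := hθ.bounded_above_of_compact_support hc
  have h2 : Integrable (fun z => f z * θ z.2)
      ((volume.restrict (Metric.ball x₀ r)).prod (volume.restrict J)) :=
    hf.mul_bdd (hθ.comp continuous_snd).aestronglyMeasurable (Eventually.of_forall fun q => hC q.2)
  rw [← h1, Measure.volume_eq_prod, ← Measure.prod_restrict, integral_prod_symm _ h2]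
  refine integral_congr_ae (Eventually.of_forall fun t => ?_)
  simp only
  rw [integral_mul_const, mul_comm]

/-- Testing the vorticity identity with products `ψ(x)θ(t)` shows that the slice defect, a locally
integrable function of `t`, is orthogonal to every test function `θ` on `J`; hence it vanishes a.e.
-/
theorem ae_curlTest {J : Set ℝ} (hJo : IsOpen J) (hΩo : IsOpen Ω) (h : IsVorticity Ω T u ω)
    (hΩ : Metric.ball x₀ r ⊆ Ω) (hJ : J ⊆ Ioo 0 T)
    (hui : Integrable u ((volume.restrict (Metric.ball x₀ r)).prod (volume.restrict J)))
    (hωi : Integrable ω ((volume.restrict (Metric.ball x₀ r)).prod (volume.restrict J)))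
    (hψ : IsBallTest x₀ r ψ) :
    ∀ᵐ t ∂(volume.restrict J), CurlTest x₀ r (fun y => u (y, t)) (fun y => ω (y, t)) ψ := by
  have iω : Integrable (fun z => ω z * ψ z.1)
      ((volume.restrict (Metric.ball x₀ r)).prod (volume.restrict J)) :=
    integrable_prod_mul_continuous hωi hψ.1.continuous hψ.2.1
  have iu : Integrable (fun z => u z 1 * partialDeriv 0 ψ z.1 - u z 0 * partialDeriv 1 ψ z.1)
      ((volume.restrict (Metric.ball x₀ r)).prod (volume.restrict J)) :=
    (integrable_prod_mul_continuous (integrable_coord hui 1)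
      (continuous_partialDeriv hψ.contDiff_one 0) (hasCompactSupport_partialDeriv hψ.2.1 0)).sub
    (integrable_prod_mul_continuous (integrable_coord hui 0)
      (continuous_partialDeriv hψ.contDiff_one 1) (hasCompactSupport_partialDeriv hψ.2.1 1))
  have jω := iω.integral_prod_right
  have ju := iu.integral_prod_right
  have key := hJo.ae_eq_zero_of_integral_contDiff_smul_eq_zero (μ := volume)
    (IntegrableOn.locallyIntegrableOn (jω.add ju)) (by
      intro θ hθ hc hs
      have hθ1 : ContDiff ℝ 1 θ := hθ.of_le (by exact_mod_cast le_top)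
      have e := h _ (hψ.isTestFunction_tensor hΩ hθ hc (hs.trans hJ))
      simp only [spatialDeriv_tensor hψ.contDiff_one hθ1] at e
      have e1 : ∀ z : Plane × ℝ, ω z * (ψ z.1 * θ z.2) = ω z * ψ z.1 * θ z.2 := fun z => by ring
      have e2 : ∀ z : Plane × ℝ, u z 1 * (partialDeriv 0 ψ z.1 * θ z.2)
          - u z 0 * (partialDeriv 1 ψ z.1 * θ z.2)
          = (u z 1 * partialDeriv 0 ψ z.1 - u z 0 * partialDeriv 1 ψ z.1) * θ z.2 :=
        fun z => by ring
      simp only [e1, e2] at e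
      rw [setIntegral_spaceTime_mul hΩo hΩ hJ iω
          (fun z hz => by rw [hψ.eq_zero hz, mul_zero]) hθ.continuous hc hs,
        setIntegral_spaceTime_mul hΩo hΩ hJ iu
          (fun z hz => by simp [hψ.partialDeriv_eq_zero hz]) hθ.continuous hc hs] at e
      obtain ⟨C, hC⟩ := hθ.continuous.bounded_above_of_compact_support hc
      have k1 := jω.bdd_mul hθ.continuous.aestronglyMeasurable (Eventually.of_forall hC)
      have k2 := ju.bdd_mul hθ.continuous.aestronglyMeasurable (Eventually.of_forall hC)
      rw [← setIntegral_eq_integral_of_forall_compl_eq_zero (s := J)]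
      · simp only [Pi.add_apply, smul_eq_mul, mul_add]
        rw [integral_add k1 k2, e]
        simp
      · intro t ht
        rw [image_eq_zero_of_notMem_tsupport fun h => ht (hs h), zero_smul])
  rw [ae_restrict_iff' hJo.measurableSet]
  filter_upwards [key] with t ht htJ
  have := ht htJ
  simp only [Pi.add_apply] at this
  rw [CurlTest]
  linarith

end Curl

/-! ### Subtracting constant vectors. -/

section Constant

variable {r : ℝ} {x₀ : Plane} {V : Plane → Plane} {W : Plane → ℝ} {ψ : Plane → ℝ}

/-- Integration by parts against the constant 1. It says that constant fields are divergence free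
and curl free, so the slice identities pass from `V` to `V - k`. -/
theorem IsBallTest.setIntegral_partialDeriv (hψ : IsBallTest x₀ r ψ) (i : Fin 2) :
    ∫ x in Metric.ball x₀ r, partialDeriv i ψ x = 0 := by
  rw [setIntegral_eq_integral_of_forall_compl_eq_zero
    fun x hx => hψ.partialDeriv_eq_zero hx i]
  have hi : Integrable (partialDeriv i ψ) :=
    (continuous_partialDeriv hψ.contDiff_one i).integrable_of_hasCompactSupport
      (hasCompactSupport_partialDeriv hψ.2.1 i)
  have h := integral_mul_fderiv_eq_neg_fderiv_mul_of_integrable (μ := volume)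
    (f := fun _ : Plane => (1 : ℝ)) (g := ψ) (v := EuclideanSpace.single i 1)
    (by simp) (by simp only [one_mul]; exact hi)
    (by simpa using hψ.1.continuous.integrable_of_hasCompactSupport hψ.2.1)
    (fun x _ => differentiableAt_const _)
    (fun x _ => hψ.contDiff_one.differentiable one_ne_zero x)
  simpa [partialDeriv] using h

theorem IsBallTest.integrableOn_const_mul_partialDeriv (hψ : IsBallTest x₀ r ψ) (i : Fin 2)
    (c : ℝ) : IntegrableOn (fun x => c * partialDeriv i ψ x) (Metric.ball x₀ r) :=
  (((continuous_partialDeriv hψ.contDiff_one i).integrable_of_hasCompactSupport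
      (hasCompactSupport_partialDeriv hψ.2.1 i)).const_mul c).integrableOn

theorem DivTest.sub_const (h : DivTest x₀ r V ψ) (hψ : IsBallTest x₀ r ψ)
    (hV : IntegrableOn V (Metric.ball x₀ r)) (k : Plane) :
    DivTest x₀ r (fun x => V x - k) ψ := by
  unfold DivTest at h ⊢
  have e : ∀ x, (V x - k) 0 * partialDeriv 0 ψ x + (V x - k) 1 * partialDeriv 1 ψ x
      = (V x 0 * partialDeriv 0 ψ x + V x 1 * partialDeriv 1 ψ x)
        - (k 0 * partialDeriv 0 ψ x + k 1 * partialDeriv 1 ψ x) := fun x => by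
    simp only [PiLp.sub_apply]; ring
  simp only [e]
  have i0 := hψ.integrableOn_const_mul_partialDeriv 0 (k 0)
  have i1 := hψ.integrableOn_const_mul_partialDeriv 1 (k 1)
  have iV := (integrableOn_ball_mul_continuous (integrable_coord hV 0)
    (continuous_partialDeriv hψ.contDiff_one 0)).fun_add (integrableOn_ball_mul_continuous
      (integrable_coord hV 1) (continuous_partialDeriv hψ.contDiff_one 1))
  rw [integral_sub iV (i0.fun_add i1), h,
    integral_add i0 i1, integral_const_mul, integral_const_mul, hψ.setIntegral_partialDeriv,
    hψ.setIntegral_partialDeriv]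
  simp

theorem CurlTest.sub_const (h : CurlTest x₀ r V W ψ) (hψ : IsBallTest x₀ r ψ)
    (hV : IntegrableOn V (Metric.ball x₀ r)) (k : Plane) :
    CurlTest x₀ r (fun x => V x - k) W ψ := by
  unfold CurlTest at h ⊢
  have e : ∀ x, (V x - k) 1 * partialDeriv 0 ψ x - (V x - k) 0 * partialDeriv 1 ψ x
      = (V x 1 * partialDeriv 0 ψ x - V x 0 * partialDeriv 1 ψ x)
        - (k 1 * partialDeriv 0 ψ x - k 0 * partialDeriv 1 ψ x) := fun x => by
    simp only [PiLp.sub_apply]; ring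
  simp only [e]
  have i0 := hψ.integrableOn_const_mul_partialDeriv 0 (k 1)
  have i1 := hψ.integrableOn_const_mul_partialDeriv 1 (k 0)
  have iV := (integrableOn_ball_mul_continuous (integrable_coord hV 1)
    (continuous_partialDeriv hψ.contDiff_one 0)).fun_sub (integrableOn_ball_mul_continuous
      (integrable_coord hV 0) (continuous_partialDeriv hψ.contDiff_one 1))
  rw [integral_sub iV (i0.fun_sub i1), h,
    integral_sub i0 i1, integral_const_mul, integral_const_mul, hψ.setIntegral_partialDeriv,
    hψ.setIntegral_partialDeriv]
  simp

end Constant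

/-! ### Averages, and uniformity of the null set in `k`. -/

theorem setAverage_nonneg {α : Type*} [MeasurableSpace α] {μ : Measure α} {s : Set α} {f : α → ℝ}
    (hf : ∀ x, 0 ≤ f x) : 0 ≤ ⨍ x in s, f x ∂μ := by
  rw [setAverage_eq]
  exact smul_nonneg (by positivity) (integral_nonneg hf)

theorem Gam_nonneg (ε : ℝ) (u : Plane × ℝ → Plane) (ω : Plane × ℝ → ℝ) (x₀ : Plane) (t₀ : ℝ)
    {r : ℝ} (hr : 0 < r) : 0 ≤ Gam ε u ω x₀ t₀ r := by
  have h1 : 0 ≤ ⨍ z in cyl x₀ t₀ (2 * r), |ω z| ^ 2 := setAverage_nonneg fun z => by positivity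
  have h2 : 0 ≤ ⨍ z in cyl x₀ t₀ (2 * r), (‖u z‖ ^ (2 + ε) + 1) :=
    setAverage_nonneg fun z => by positivity
  unfold Gam
  exact mul_nonneg (mul_nonneg (by positivity) (Real.rpow_nonneg h1 _)) (Real.rpow_nonneg h2 _)

theorem isFiniteMeasure_restrict_ball (x : Plane) (r : ℝ) :
    IsFiniteMeasure (volume.restrict (Metric.ball x r)) :=
  ⟨by rw [Measure.restrict_apply_univ]; exact measure_ball_lt_top⟩

theorem continuous_setAverage_norm_sub {x₀ : Plane} {r : ℝ} {U : Plane → Plane}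
    (hU : IntegrableOn U (Metric.ball x₀ r)) :
    Continuous fun k : Plane => ⨍ y in Metric.ball x₀ r, ‖U y - k‖ := by
  suffices h : Continuous fun k : Plane => ∫ y in Metric.ball x₀ r, ‖U y - k‖ by
    simp only [setAverage_eq, smul_eq_mul]
    exact continuous_const.mul h
  refine continuous_iff_continuousAt.mpr fun k => ?_
  have : IsFiniteMeasure (volume.restrict (Metric.ball x₀ r)) :=
    isFiniteMeasure_restrict_ball _ _
  refine continuousAt_of_dominated (bound := fun y => ‖U y‖ + (‖k‖ + 1))
    (Eventually.of_forall fun k' => (hU.1.sub aestronglyMeasurable_const).norm) ?_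
    (hU.norm.add (integrable_const _)) (Eventually.of_forall fun y => by fun_prop)
  filter_upwards [Metric.ball_mem_nhds k one_pos] with k' hk'
  refine Eventually.of_forall fun y => ?_
  rw [Metric.mem_ball, dist_eq_norm] at hk'
  have h1 := norm_sub_le (U y) k'
  have h2 := norm_le_norm_add_norm_sub' k' k
  rw [norm_norm]
  linarith

theorem setAverage_ball_le_setAverage_double {x₀ : Plane} {r : ℝ} (hr : 0 < r) {f : Plane → ℝ}
    (hf : IntegrableOn f (Metric.ball x₀ (2 * r))) (h0 : ∀ y, 0 ≤ f y) :
    ⨍ y in Metric.ball x₀ r, f y ≤ 4 * ⨍ y in Metric.ball x₀ (2 * r), f y := by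
  have hpi := Real.pi_pos
  have h1 : ∫ y in Metric.ball x₀ r, f y ≤ ∫ y in Metric.ball x₀ (2 * r), f y :=
    setIntegral_mono_set hf (Eventually.of_forall h0)
      (Metric.ball_subset_ball (by linarith)).eventuallyLE
  rw [setAverage_eq, setAverage_eq, volume_real_ball_plane _ hr.le,
    volume_real_ball_plane _ (by positivity), smul_eq_mul, smul_eq_mul]
  have e : 4 * ((Real.pi * (2 * r) ^ 2)⁻¹ * ∫ y in Metric.ball x₀ (2 * r), f y)
      = (Real.pi * r ^ 2)⁻¹ * ∫ y in Metric.ball x₀ (2 * r), f y := by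
    field_simp
    ring
  rw [e]
  exact mul_le_mul_of_nonneg_left h1 (by positivity)

/-- Both sides are continuous in `k`, so countably many values of `k` suffice. -/
theorem forall_of_denseSeq_estimate {x₀ w : Plane} {r A B : ℝ} {U : Plane → Plane}
    (hU : IntegrableOn U (Metric.ball x₀ r))
    (h : ∀ n, ‖w - TopologicalSpace.denseSeq Plane n‖
      ≤ A + B * ⨍ y in Metric.ball x₀ r, ‖U y - TopologicalSpace.denseSeq Plane n‖) (k : Plane) :
    ‖w - k‖ ≤ A + B * ⨍ y in Metric.ball x₀ r, ‖U y - k‖ := by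
  have hcont := continuous_setAverage_norm_sub hU
  refine (TopologicalSpace.denseRange_denseSeq Plane).induction_on k
    (isClosed_le (by fun_prop) (by fun_prop)) h

end EulerLocal

/-! ### The local estimate for Euler solutions. -/

theorem lemma3p1 (ε V₀ : ℝ) (hε : 0 < ε) (hV₀ : 0 < V₀) :
    ∃ C : ℝ, 0 < C ∧
      ∀ (Ω : Set EulerLocal.Plane) (T : ℝ)
        (u : EulerLocal.Plane × ℝ → EulerLocal.Plane) (ω : EulerLocal.Plane × ℝ → ℝ)
        (x₀ : EulerLocal.Plane) (t₀ r σ : ℝ),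
        IsOpen Ω → 0 < r → 0 < σ → σ < 1 →
        closure (EulerLocal.cyl x₀ t₀ (2 * r)) ⊆ EulerLocal.spaceTime Ω T →
        EulerLocal.IsWeakSolution Ω T u →
        EulerLocal.VorticityEstimates Ω T u ω V₀ →
        MemLp u (ENNReal.ofReal (2 + ε)) (volume.restrict (EulerLocal.cyl x₀ t₀ (2 * r))) →
        ∀ᵐ z ∂(volume.restrict (EulerLocal.cyl x₀ t₀ (σ * r))),
          -- the integrals in the estimates below exist
          IntegrableOn (fun y => u (y, z.2)) (Metric.ball x₀ (2 * r)) ∧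
          IntegrableOn (fun y => |ω (y, z.2)| / ‖z.1 - y‖) (Metric.ball x₀ r) ∧
          -- the estimate with an arbitrary constant vector `k`
          (∀ k : EulerLocal.Plane,
            ‖u z - k‖ ≤
              1 / (2 * Real.pi) * (∫ y in Metric.ball x₀ r, |ω (y, z.2)| / ‖z.1 - y‖)
              + C / (1 - σ) ^ 3 *
                ((⨍ y in Metric.ball x₀ r, ‖u (y, z.2) - k‖)
                  + EulerLocal.Gam ε u ω x₀ t₀ r)) ∧
          -- the estimate with the spatial mean of `u(·, t)` over `2B`
          ‖u z - ⨍ y in Metric.ball x₀ (2 * r), u (y, z.2)‖ ≤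
            1 / (2 * Real.pi) * (∫ y in Metric.ball x₀ r, |ω (y, z.2)| / ‖z.1 - y‖)
            + C / (1 - σ) ^ 3 *
              ((⨍ y in Metric.ball x₀ (2 * r),
                  ‖u (y, z.2) - ⨍ y' in Metric.ball x₀ (2 * r), u (y', z.2)‖)
                + EulerLocal.Gam ε u ω x₀ t₀ r) := by
  obtain ⟨C, hC, hest⟩ := EulerLocal.exists_interior_estimate
  -- The factor 4 is `|2B|/|B|`, needed to replace the mean over `B` by the mean over `2B` in the
  -- second estimate.
  refine ⟨4 * C, by positivity, ?_⟩
  intro Ω T u ω x₀ t₀ r σ hΩo hr hσ hσ1 hsub hu hVE _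
  have hr2 : 0 < 2 * r := by positivity
  have hs : 0 < 1 - σ := by linarith
  have hball : Metric.ball x₀ r ⊆ Metric.ball x₀ (2 * r) := Metric.ball_subset_ball (by linarith)
  have hΩ : Metric.ball x₀ r ⊆ Ω :=
    hball.trans (EulerLocal.ball_subset_of_closure_cyl_subset hr2 hsub)
  have hJ := EulerLocal.Ioo_subset_of_closure_cyl_subset hr2 hsub
  set J := Ioo (t₀ - 2 * r) t₀ with hJdef
  have hui2 := EulerLocal.integrable_cyl_of_memL2Loc hr2 hsub hu.memL2Loc
  have hωi2 := EulerLocal.integrable_cyl_of_memL2Loc hr2 hsub hVE.memL2Loc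
  have hmono : (volume.restrict (Metric.ball x₀ r)).prod (volume.restrict J)
      ≤ (volume.restrict (Metric.ball x₀ (2 * r))).prod (volume.restrict J) :=
    Measure.prod_mono (Measure.restrict_mono hball le_rfl) le_rfl
  have hui := hui2.mono_measure hmono
  have hωi := hωi2.mono_measure hmono
  have hut : ∀ᵐ t ∂(volume.restrict J),
      IntegrableOn (fun y => u (y, t)) (Metric.ball x₀ (2 * r)) := hui2.prod_left_ae
  have hfin : IsFiniteMeasure
      ((volume.restrict (Metric.ball x₀ r)).prod (volume.restrict J)) := by
    have : IsFiniteMeasure (volume.restrict (Metric.ball x₀ r)) :=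
      EulerLocal.isFiniteMeasure_restrict_ball _ _
    infer_instance
  have hk : ∀ᵐ z ∂((volume.restrict (Metric.ball x₀ r)).prod (volume.restrict J)), ∀ n,
      z.1 ∈ Metric.ball x₀ (σ * r) →
      ‖u z - TopologicalSpace.denseSeq EulerLocal.Plane n‖
        ≤ 1 / (2 * Real.pi) * (∫ y in Metric.ball x₀ r, |ω (y, z.2)| / ‖z.1 - y‖)
          + C / (1 - σ) ^ 3 * ⨍ y in Metric.ball x₀ r,
            ‖u (y, z.2) - TopologicalSpace.denseSeq EulerLocal.Plane n‖ := by
    rw [ae_all_iff]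
    intro n
    refine hest x₀ r σ (volume.restrict J)
      (fun z => u z - TopologicalSpace.denseSeq EulerLocal.Plane n) ω hr hσ hσ1
      (hui.sub (integrable_const _)) hωi (fun ψ hψ => ?_) (fun ψ hψ => ?_)
    · filter_upwards [EulerLocal.ae_divTest hΩo hu hΩ hJ hui hψ, hut] with t h1 h2
      exact h1.sub_const hψ (h2.mono_set hball) _
    · filter_upwards [EulerLocal.ae_curlTest isOpen_Ioo hΩo hVE.isVorticity hΩ hJ hui hωi hψ, hut]
        with t h1 h2
      exact h1.sub_const hψ (h2.mono_set hball) _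
  have hcyl : EulerLocal.cyl x₀ t₀ (σ * r) ⊆ Metric.ball x₀ r ×ˢ J :=
    prod_mono (Metric.ball_subset_ball (by nlinarith)) (Ioo_subset_Ioo (by nlinarith) le_rfl)
  have hall := hk.and ((EulerLocal.ae_integrableOn_vorticity_div_norm hωi).and
    (Measure.quasiMeasurePreserving_snd.ae hut))
  rw [Measure.prod_restrict] at hall
  filter_upwards [ae_restrict_of_ae_restrict_of_subset hcyl hall,
    ae_restrict_mem (Metric.isOpen_ball.measurableSet.prod measurableSet_Ioo)]
    with z ⟨hz, hωz, huz⟩ hzc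
  have hΓ := EulerLocal.Gam_nonneg ε u ω x₀ t₀ hr
  have hmain := EulerLocal.forall_of_denseSeq_estimate (huz.mono_set hball) (fun n => hz n hzc.1)
  -- The second estimate is the first with `k` equal to the mean over `2B`. That mean depends on
  -- `t`, so it is essential that `hmain` holds for all `k` at the same point `z`.
  refine ⟨huz, hωz, fun k => (hmain k).trans ?_, (hmain _).trans ?_⟩
  · have hav : 0 ≤ ⨍ y in Metric.ball x₀ r, ‖u (y, z.2) - k‖ :=
      EulerLocal.setAverage_nonneg fun _ => norm_nonneg _
    refine add_le_add le_rfl (mul_le_mul ?_ (by linarith) hav (by positivity))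
    gcongr
    linarith
  · set m := ⨍ y in Metric.ball x₀ (2 * r), u (y, z.2)
    have hfin2 : IsFiniteMeasure (volume.restrict (Metric.ball x₀ (2 * r))) :=
      EulerLocal.isFiniteMeasure_restrict_ball _ _
    have hav := EulerLocal.setAverage_ball_le_setAverage_double hr
      (f := fun y => ‖u (y, z.2) - m‖) (Integrable.norm (huz.sub (integrable_const m)))
      (fun _ => norm_nonneg _)
    refine add_le_add le_rfl ?_
    have e : 4 * C / (1 - σ) ^ 3 * ((⨍ y in Metric.ball x₀ (2 * r), ‖u (y, z.2) - m‖)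
          + EulerLocal.Gam ε u ω x₀ t₀ r)
        = C / (1 - σ) ^ 3 * (4 * (⨍ y in Metric.ball x₀ (2 * r), ‖u (y, z.2) - m‖)
          + 4 * EulerLocal.Gam ε u ω x₀ t₀ r) := by ring
    rw [e]
    exact mul_le_mul_of_nonneg_left (by linarith) (by positivity)
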